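/- A fair division instance consists of $n$ agents $[n]$, $m$ indivisible items $[m]$ and additive valuations $v_a(S)=\sum_{g\in S}v_a(g)$ with $0\le v_a(g)\le 1$ for all agents $a$ and items $g$. Put $\mathsf{PROP}_a=v_a([m])/n$, and let $\log$ be the logarithm to base $2$. Consider the following algorithm BoundedProp for an arrival order $\tau=\langle\tau_1,\dots,\tau_n\rangle$ of the agents. A stage with remaining agents $a_1,\dots,a_r$ (in the order of arrival) and remaining items $U$ is as follows. If $r=1$, then $a_1$ receives $U$. If $r\ge 2$, let $\mathrm{mid}=\lfloor r/2\rfloor$. Run Round-Robin on $U$: the agents $a_1,\dots,a_r$ cyclically take their most preferred remaining item (among equally preferred items the one of smallest index) until all items are taken. Let $M[p]$ be the set of items taken by $a_p$ and $M[j,p]$ the $j$-th item taken by $a_p$. Then $a_1,\dots,a_{\mathrm{mid}}$ arrive in this order. Let $D$ be the set of the items $M[j,p]$ with $j\in\{1,2\}$, $p>\mathrm{mid}$ and $M[p]$ unpicked that are still in $M[p]$. When $a_i$ arrives: * if $i=\mathrm{mid}$, all items of $D$ are moved to $M[i]$, and the unpicked parts are presented to $a_i$; * if $i<\mathrm{mid}$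 and $v_{a_i}(g)>0$ for some $g\in D$, one such $g$ (the one of smallest index) is moved to $M[i]$, and the unpicked parts are presented to $a_i$; * otherwise a temporary partition $M'$ is presented (again only its unpicked parts), which arises from $M$ by swapping $M[1,i+k]$ with $M[1,\mathrm{mid}+k]$ for all $1\le k\le\mathrm{mid}-i$ for which $M[i+k]$ and $M[\mathrm{mid}+k]$ are unpicked (if one of the two items is no longer in its part, only the other one moves). After the pick, $M$ is restored, unless the part picked differs from its counterpart in $M$, in which case $M'$ is kept. If $M[i]$ has already been picked by another agent, the unpicked parts are presented to $a_i$ unchanged. Each agent picks one of the presented parts and departs with it. After the arrival of $a_{\mathrm{mid}}$, the items of the unpicked parts are pooled, and the next stage runs with the agents $a_{\mathrm{mid}+1},\dots,a_r$ and these items. The first stage has the agents $\tau_1,\dots,\tau_n$ and the items $[m]$. Agents pick rationally if each picks a part of highest value for them among the presented ones, ties being broken arbitrarily. **Theorem.** There is an algorithm that, for every fair division instance, computes in time polynomial in $n+m$ an arrival order $\tau$ with the following properties. (The algorithm is a program of a random access machine that adds, subtracts and compares indices and values at unit cost.) 1. $\tau$ is greedy: for every $i\in[n]$, if some agent $a\notin\{\tau_1,\dots,\tau_{i-1}\}$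 has $\mathsf{PROP}_a\ge 2(\lceil\log i\rceil+1)$, then $\tau_i$ is such an agent. 2. When BoundedProp is run with the arrival order $\tau$ and all agents pick rationally, then for every $i\in[n]$ the agent $\tau_i$ receives a part of value at least $\mathsf{PROP}_{\tau_i}-2\lceil\log i\rceil-2$, however the agents break ties. -/

import Mathlib

noncomputable section

/-! ### Fair division instances -/

/-- A fair division instance with `n` agents and `m` indivisible items: additive valuations,
given by the values of the single items, normalized so that every item has value in `[0, 1]`. -/
structure FairInstance (n m : ℕ) where
  val : Fin n → Fin m → ℝ
  nonneg : ∀ a g, 0 ≤ val a g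
  le_one : ∀ a g, val a g ≤ 1

/-- A labelled family of parts; the labels are the agents. -/
abbrev Parts (n m : ℕ) : Type := Fin n → Finset (Fin m)

/-- A choice behaviour of the agents: `c a avail P` is the label of the part that agent `a` picks
when shown the parts `P q` with `q ∈ avail`. -/
abbrev Choice (n m : ℕ) : Type := Fin n → Finset (Fin n) → Parts n m → Fin n

namespace FairInstance

variable {n m : ℕ} (I : FairInstance n m)

/-- The (additive) value of a set of items. -/
def value (a : Fin n) (S : Finset (Fin m)) : ℝ := ∑ g ∈ S, I.val a g

/-- The proportional share `v_a([m]) / n`. -/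
def prop (a : Fin n) : ℝ := I.value a Finset.univ / n

/-- All agents pick rationally: from every nonempty menu, each agent picks one of the presented
parts, and one of highest value for them. Ties are broken in any way whatsoever. -/
def IsRational (c : Choice n m) : Prop :=
  ∀ (a : Fin n) (avail : Finset (Fin n)) (P : Parts n m), avail.Nonempty →
    c a avail P ∈ avail ∧ ∀ q ∈ avail, I.value a (P q) ≤ I.value a (P (c a avail P))

/-! ### Round-Robin -/

/-- The most preferred item of agent `a` in `U`, the one of smallest index among equally
preferred ones; `none` if `U` is empty. -/
def topItem (a : Fin n) (U : Finset (Fin m)) : Option (Fin m) :=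
  ((U.filter fun g => ∀ h ∈ U, I.val a h ≤ I.val a g).sort (· ≤ ·)).head?

/-- The agents of the list take turns; each takes their most preferred remaining item, until no
item remains. The result is the list of the picks in the order in which they are made. -/
def serialPicks : List (Fin n) → Finset (Fin m) → List (Fin n × Fin m)
  | [], _ => []
  | a :: as, U =>
    match I.topItem a U with
    | none => []
    | some g => (a, g) :: serialPicks as (U.erase g)

/-- Round-Robin on the items `U` with the cyclic picking sequence `L`, viewed as a matrix: the
entry of row `r` in column `a` is the `r`-th pick (counted from `0`) of agent `a`. One has at most
`U.card` rounds. -/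
def roundRobin (L : List (Fin n)) (U : Finset (Fin m)) (a : Fin n) : List (Fin m) :=
  ((I.serialPicks (List.replicate U.card L).flatten U).filter (fun x => x.1 = a)).map Prod.snd

/-! ### The algorithm for bounded proportional shares -/

end FairInstance

namespace BoundedProp

variable {n m : ℕ}

/-- The entry in row `j` (counted from `0`) of column `a` of the matrix `R`, as a set with at most
one element: it is empty (the entry is `⊥`) if there is no such entry or if the item has been
removed from the part `P a`. -/
def cell (R : Fin n → List (Fin m)) (P : Parts n m) (j : ℕ) (a : Fin n) : Finset (Fin m) :=
  (R a)[j]?.toFinset ∩ P a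

/-- The items in the top two rows of the unpicked donor parts. -/
def donorItems (R : Fin n → List (Fin m)) (P : Parts n m) (avail : Finset (Fin n))
    (donors : List (Fin n)) : Finset (Fin m) :=
  (donors.toFinset ∩ avail).biUnion fun d => cell R P 0 d ∪ cell R P 1 d

/-- Move the items of `S` to the part labelled `a`. -/
def transfer (P : Parts n m) (S : Finset (Fin m)) (a : Fin n) : Parts n m :=
  fun q => if q = a then P q ∪ S else P q \ S

/-- Swap the top entries of the columns `b` and `d`. If one of the entries is `⊥`, then the other
one just moves. -/
def swapTop (R : Fin n → List (Fin m)) (P : Parts n m) (b d : Fin n) : Parts n m :=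
  transfer (transfer P (cell R P 0 b) d) (cell R P 0 d) b

/-- The temporary partition: the top entries of the columns in each of the given (disjoint) pairs
are swapped. Parts that have been picked already are left alone. -/
def rebundle (R : Fin n → List (Fin m)) (P : Parts n m) (avail : Finset (Fin n))
    (pairs : List (Fin n × Fin n)) : Parts n m :=
  (pairs.filter fun x => x.1 ∈ avail ∧ x.2 ∈ avail).foldl (fun Q x => swapTop R Q x.1 x.2) P

/-- The state of a stage: the current parts, the labels of the unpicked parts, and the parts that
the agents have received so far. -/
structure StageState (n m : ℕ) where
  parts : Parts n m
  avail : Finset (Fin n)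
  got : Parts n m

/-- Agent `a` is shown the unpicked parts of `P` and takes one of them. Afterwards the parts
that remain are those of `next q`, where `q` is the label of the part taken. -/
def present (c : Choice n m) (a : Fin n) (P : Parts n m) (next : Fin n → Parts n m)
    (s : StageState n m) : StageState n m where
  parts := next (c a s.avail P)
  avail := s.avail.erase (c a s.avail P)
  got := Function.update s.got a (P (c a s.avail P))

/-- The arrival of agent `a` in a stage with Round-Robin matrix `R`. Here `later` lists the agents
of the stage that arrive after `a`, and `donors` lists the agents left to the next stages.

* If `a` is the last agent of the stage, then all items left in the top two rows of the donors are
  added to the part of `a`.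
* Otherwise, if `a` values one of these items positively, then such an item is moved to the part
  of `a`.
* Otherwise a temporary partition is presented, in which the top items of the `k`-th later agent
  and of the `k`-th donor are swapped for all `k`.

The temporary partition is discarded after the pick; only if the part taken was affected by the
swaps (so that the old partition is no longer there) it is kept. If the part of `a` has been
taken by an earlier agent, then the unpicked parts are presented unchanged. -/
def arrive (I : FairInstance n m) (c : Choice n m) (R : Fin n → List (Fin m))
    (donors later : List (Fin n)) (a : Fin n) (s : StageState n m) : StageState n m :=
  let D := donorItems R s.parts s.avail donors
  let Dpos := D.filter fun g => 0 < I.val a g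
  if a ∉ s.avail then
    present c a s.parts (fun _ => s.parts) s
  else if later = [] then
    let P := transfer s.parts D a
    present c a P (fun _ => P) s
  else if h : Dpos.Nonempty then
    let P := transfer s.parts {Dpos.min' h} a
    present c a P (fun _ => P) s
  else
    let P := rebundle R s.parts s.avail (later.zip donors)
    present c a P (fun q => if P q = s.parts q then s.parts else P) s

/-- The picking phase of a stage: the agents of the list arrive one after the other. -/
def picking (I : FairInstance n m) (c : Choice n m) (R : Fin n → List (Fin m))
    (donors : List (Fin n)) : List (Fin n) → StageState n m → StageState n m
  | [], s => s
  | a :: later, s => picking I c R donors later (arrive I c R donors later a s)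

/-- The recursive algorithm for the agents `L` (in the order of their arrival) and the items `U`,
when the agents that have arrived before have received the parts `got`. In a stage the first half
of the agents (rounded down) pick; then the items of the unpicked parts are pooled. -/
def run (I : FairInstance n m) (c : Choice n m) (L : List (Fin n)) (U : Finset (Fin m))
    (got : Parts n m) : Parts n m :=
  match L with
  | [] => got
  | [a] => Function.update got a U
  | a :: b :: L' =>
    let L := a :: b :: L'
    let mid := L.length / 2
    let R := I.roundRobin L U
    let s := picking I c R (L.drop mid) (L.take mid)
      { parts := fun q => (R q).toFinset, avail := L.toFinset, got := got }
    run I c (L.drop mid) (s.avail.biUnion s.parts) s.got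
  termination_by L.length
  decreasing_by
    simp only [List.length_drop, List.length_cons]
    omega

end BoundedProp

namespace FairInstance

variable {n m : ℕ} (I : FairInstance n m)

/-- The part that each agent receives when the algorithm is run with the arrival order
`τ 0, τ 1, …, τ (n - 1)` and the agents pick according to `c`. -/
def boundedProp (τ : Equiv.Perm (Fin n)) (c : Choice n m) : Parts n m :=
  BoundedProp.run I c (List.ofFn τ) Finset.univ (fun _ => ∅)

/-- `⌈log₂ i⌉` for the `i`-th position, where the position `i = k + 1` is given by `k : Fin n`. -/
def logPos (k : Fin n) : ℤ := ⌈Real.logb 2 ((k : ℝ) + 1)⌉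

/-- `τ` is a greedy arrival order: the positions are filled one after the other, and position `i`
goes to an agent `a` with `PROP_a ≥ 2 (⌈log i⌉ + 1)` whenever some agent without an earlier
position is of this kind. -/
def IsGreedyOrder (τ : Equiv.Perm (Fin n)) : Prop :=
  ∀ k l : Fin n, k ≤ l →
    2 * ((logPos k : ℝ) + 1) ≤ I.prop (τ l) → 2 * ((logPos k : ℝ) + 1) ≤ I.prop (τ k)

end FairInstance

/-! ### A machine model with a step count

A random access machine with registers and an unbounded memory for natural numbers (indices) and
likewise for real numbers (values). Its instructions on numbers are constants, addition,
subtraction (truncated for indices) and comparison, at unit cost; there is no multiplication,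
division or rounding. After `t` steps every value is thus an integer combination of the input
values and of a constant, with coefficients of `O(t)` bits, so that a polynomial number of steps
is also polynomial time in the bit model if the input values are rational. -/

namespace RAM

/-- Programs. The arguments are numbers of registers, except for the constants `k`. -/
inductive Prog : Type
  /-- index register `d` becomes the constant `k` -/
  | setI (d k : ℕ)
  /-- index register `d` becomes the sum of the index registers `x` and `y` -/
  | addI (d x y : ℕ)
  /-- index register `d` becomes the truncated difference of the index registers `x` and `y` -/
  | subI (d x y : ℕ)
  /-- index register `d` becomes the content of the index memory at the address in `x` -/
  | loadI (d x : ℕ)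
  /-- the index memory at the address in `x` becomes the content of the index register `y` -/
  | storeI (x y : ℕ)
  /-- value register `d` becomes the constant `k` -/
  | setV (d k : ℕ)
  /-- value register `d` becomes the sum of the value registers `x` and `y` -/
  | addV (d x y : ℕ)
  /-- value register `d` becomes the difference of the value registers `x` and `y` -/
  | subV (d x y : ℕ)
  /-- value register `d` becomes the content of the value memory at the address in `x` -/
  | loadV (d x : ℕ)
  /-- the value memory at the address in `x` becomes the content of the value register `y` -/
  | storeV (x y : ℕ)
  /-- value register `d` becomes the input entry at the indices in the registers `x` and `y` -/
  | input (d x y : ℕ)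
  /-- first `p`, then `q` -/
  | seq (p q : Prog)
  /-- `p` if index register `x` is less than index register `y`, otherwise `q` -/
  | ifI (x y : ℕ) (p q : Prog)
  /-- `p` if value register `x` is less than value register `y`, otherwise `q` -/
  | ifV (x y : ℕ) (p q : Prog)
  /-- repeat `p` while index register `x` is less than index register `y` -/
  | whileI (x y : ℕ) (p : Prog)

/-- The state of the machine. -/
structure State where
  idx : ℕ → ℕ
  mem : ℕ → ℕ
  val : ℕ → ℝ
  vmem : ℕ → ℝ

open Function in
/-- `Exec inp p s t s'`: started in state `s` with the read-only input table `inp`, the program `p`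
halts in state `s'` after exactly `t` steps. -/
inductive Exec (inp : ℕ → ℕ → ℝ) : Prog → State → ℕ → State → Prop
  | setI (d k s) : Exec inp (.setI d k) s 1 { s with idx := update s.idx d k }
  | addI (d x y s) : Exec inp (.addI d x y) s 1
      { s with idx := update s.idx d (s.idx x + s.idx y) }
  | subI (d x y s) : Exec inp (.subI d x y) s 1
      { s with idx := update s.idx d (s.idx x - s.idx y) }
  | loadI (d x s) : Exec inp (.loadI d x) s 1
      { s with idx := update s.idx d (s.mem (s.idx x)) }
  | storeI (x y s) : Exec inp (.storeI x y) s 1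
      { s with mem := update s.mem (s.idx x) (s.idx y) }
  | setV (d k s) : Exec inp (.setV d k) s 1 { s with val := update s.val d (k : ℝ) }
  | addV (d x y s) : Exec inp (.addV d x y) s 1
      { s with val := update s.val d (s.val x + s.val y) }
  | subV (d x y s) : Exec inp (.subV d x y) s 1
      { s with val := update s.val d (s.val x - s.val y) }
  | loadV (d x s) : Exec inp (.loadV d x) s 1
      { s with val := update s.val d (s.vmem (s.idx x)) }
  | storeV (x y s) : Exec inp (.storeV x y) s 1
      { s with vmem := update s.vmem (s.idx x) (s.val y) }
  | input (d x y s) : Exec inp (.input d x y) s 1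
      { s with val := update s.val d (inp (s.idx x) (s.idx y)) }
  | seq {p q s t s' t' s''} : Exec inp p s t s' → Exec inp q s' t' s'' →
      Exec inp (.seq p q) s (t + t') s''
  | ifI_lt {x y p q s t s'} : s.idx x < s.idx y → Exec inp p s t s' →
      Exec inp (.ifI x y p q) s (t + 1) s'
  | ifI_ge {x y p q s t s'} : s.idx y ≤ s.idx x → Exec inp q s t s' →
      Exec inp (.ifI x y p q) s (t + 1) s'
  | ifV_lt {x y p q s t s'} : s.val x < s.val y → Exec inp p s t s' →
      Exec inp (.ifV x y p q) s (t + 1) s'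
  | ifV_ge {x y p q s t s'} : s.val y ≤ s.val x → Exec inp q s t s' →
      Exec inp (.ifV x y p q) s (t + 1) s'
  | while_lt {x y p s t s' t' s''} : s.idx x < s.idx y → Exec inp p s t s' →
      Exec inp (.whileI x y p) s' t' s'' → Exec inp (.whileI x y p) s (t + t' + 1) s''
  | while_ge {x y p s} : s.idx y ≤ s.idx x → Exec inp (.whileI x y p) s 1 s

/-- The initial state: `n` and `m` are in the index registers `0` and `1`; all else is `0`. -/
def start (n m : ℕ) : State where
  idx := fun r => if r = 0 then n else if r = 1 then m else 0
  mem := fun _ => 0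
  val := fun _ => 0
  vmem := fun _ => 0

/-- The values of the items for the agents as an input table, padded by `0`. -/
def table {n m : ℕ} (I : FairInstance n m) (a g : ℕ) : ℝ :=
  if h : a < n ∧ g < m then I.val ⟨a, h.1⟩ ⟨g, h.2⟩ else 0

/-- On the instance `I`, the program `p` halts after at most `T` steps with the arrival order
`τ 0, …, τ (n - 1)` in the first `n` cells of the index memory. -/
def ComputesOrder {n m : ℕ} (p : Prog) (I : FairInstance n m) (τ : Equiv.Perm (Fin n))
    (T : ℕ) : Prop :=
  ∃ t s, Exec (table I) p (start n m) t s ∧ t ≤ T ∧ ∀ k : Fin n, s.mem k = τ k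

end RAM

end

/-!
In a Round-Robin, the column of every agent dominates, row by row and in the agent's own valuation,
the columns of the later agents, and also the columns of the earlier agents without their first
entries. Hence it is worth more than the proportional share minus one. An agent whose column starts
with two positive entries strictly prefers their own part to every other part presented: either a
transfer of donor items makes it worth more, or the top two donor rows are worthless to the agent,
and after the swaps every other part has a worthless entry in the first or the second row. So, as
long as the shares are large, everybody picks their own part, and the columns of the agents who are
left to the next stage lose at most their first two entries, whose value is at most two. What
remains of these columns is the Round-Robin of the next stage. As positions are halved from stage to
stage, the agent at position `i` loses at most `2⌈log i⌉`.

A greedy order makes the shares of all the agents in front of a large one large too. Any order of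
decreasing shares is greedy, and a program finds one by storing each agent at its rank.
-/

noncomputable section

/-! ### Picking sequences -/

/-- The sorting key of `x` in the order by decreasing value, ties being broken in favour of the
smaller element. It stands for the preferences of an agent on the items, and for the ranking of the
agents by their total values. -/
def descLex {ι : Type*} (v : ι → ℝ) (x : ι) : ℝ ×ₗ ι := toLex (-v x, x)

theorem descLex_injective {ι : Type*} (v : ι → ℝ) : Function.Injective (descLex v) :=
  fun _ _ h => congrArg (fun z => (ofLex z).2) h

theorem descLex_le_descLex {ι : Type*} [LinearOrder ι] {v : ι → ℝ} {x y : ι} :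
    descLex v x ≤ descLex v y ↔ v y < v x ∨ v x = v y ∧ x ≤ y := by
  simp [descLex, Prod.Lex.toLex_le_toLex]

theorem descLex_lt_descLex {ι : Type*} [LinearOrder ι] {v : ι → ℝ} {x y : ι} :
    descLex v x < descLex v y ↔ v y < v x ∨ v x = v y ∧ x < y := by
  simp [descLex, Prod.Lex.toLex_lt_toLex]

theorem le_of_descLex_le {ι : Type*} [LinearOrder ι] {v : ι → ℝ} {x y : ι}
    (h : descLex v x ≤ descLex v y) : v y ≤ v x :=
  (descLex_le_descLex.1 h).elim le_of_lt fun h => h.1.ge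

theorem head?_sort_eq_some_iff {ι : Type*} [LinearOrder ι] {s : Finset ι} {x : ι} :
    (s.sort (· ≤ ·)).head? = some x ↔ IsLeast (s : Set ι) x := by
  rcases s.eq_empty_or_nonempty with rfl | hs
  · simp [IsLeast]
  · have hmin : (s.sort (· ≤ ·)).head? = some (s.min' hs) := by
      rw [s.min'_eq_sorted_zero, List.head?_eq_getElem?, List.getElem?_eq_getElem]
    rw [hmin, Option.some_inj]
    exact ⟨fun h => h ▸ s.isLeast_min' hs, (s.isLeast_min' hs).unique⟩

theorem flatten_replicate_prefix {α : Type*} (L : List α) {M N : ℕ} (h : M ≤ N) :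
    (List.replicate M L).flatten <+: (List.replicate N L).flatten := by
  obtain ⟨k, rfl⟩ := Nat.exists_eq_add_of_le h
  rw [List.replicate_add, List.flatten_append]
  exact List.prefix_append _ _

theorem filter_mem_drop {α : Type*} [DecidableEq α] {L : List α} (hL : L.Nodup) (k : ℕ) :
    L.filter (fun a => a ∈ L.drop k) = L.drop k := by
  have hdisj : ∀ a ∈ L.take k, a ∉ L.drop k := fun _ h => List.disjoint_take_drop hL le_rfl h
  calc L.filter (fun a => a ∈ L.drop k)
      = (L.take k ++ L.drop k).filter (fun a => a ∈ L.drop k) := by rw [List.take_append_drop]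
    _ = L.drop k := by
      rw [List.filter_append, List.filter_eq_nil_iff.2 (by simpa using hdisj),
        List.filter_eq_self.2 (by simp), List.nil_append]

namespace FairInstance

variable {n m : ℕ} (I : FairInstance n m)

theorem topItem_eq_some_iff {a : Fin n} {U : Finset (Fin m)} {g : Fin m} :
    I.topItem a U = some g ↔
      g ∈ U ∧ ∀ x ∈ U, descLex (I.val a) g ≤ descLex (I.val a) x := by
  simp only [topItem, head?_sort_eq_some_iff, IsLeast, mem_lowerBounds, Finset.mem_coe,
    Finset.mem_filter, descLex_le_descLex]
  constructor
  · rintro ⟨⟨hg, hmax⟩, hmin⟩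
    refine ⟨hg, fun x hx => (hmax x hx).lt_or_eq.imp_right fun h => ⟨h.symm, hmin x ⟨hx, ?_⟩⟩⟩
    exact fun y hy => h ▸ hmax y hy
  · rintro ⟨hg, h⟩
    refine ⟨⟨hg, fun x hx => (h x hx).elim le_of_lt fun h => h.1.ge⟩, fun x ⟨hx, hmax⟩ => ?_⟩
    exact ((h x hx).resolve_left (hmax g hg).not_gt).2

theorem exists_topItem (a : Fin n) {U : Finset (Fin m)} (hU : U.Nonempty) :
    ∃ g, I.topItem a U = some g :=
  (U.exists_min_image (descLex (I.val a)) hU).imp fun _ => I.topItem_eq_some_iff.2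

/-- The order between the picks of a picking sequence: the agent who makes the earlier pick `x`
prefers their own item to the item of the later pick `y`. -/
def PickOrder (x y : Fin n × Fin m) : Prop := descLex (I.val x.1) x.2 < descLex (I.val x.1) y.2

variable {I} in
theorem PickOrder.val_le {x y : Fin n × Fin m} (h : I.PickOrder x y) :
    I.val x.1 y.2 ≤ I.val x.1 x.2 :=
  le_of_descLex_le h.le

theorem serialPicks_fst_prefix (as : List (Fin n)) (U : Finset (Fin m)) :
    (I.serialPicks as U).map Prod.fst <+: as := by
  induction as generalizing U with
  | nil => simp [serialPicks]
  | cons a as ih =>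
    unfold serialPicks
    cases I.topItem a U with
    | none => simp
    | some g => simpa using ih (U.erase g)

theorem mem_of_mem_serialPicks (as : List (Fin n)) (U : Finset (Fin m)) :
    ∀ x ∈ I.serialPicks as U, x.2 ∈ U := by
  induction as generalizing U with
  | nil => simp [serialPicks]
  | cons a as ih =>
    unfold serialPicks
    cases hg : I.topItem a U with
    | none => simp
    | some g =>
      exact List.forall_mem_cons.2 ⟨(I.topItem_eq_some_iff.1 hg).1,
        fun x hx => Finset.mem_of_mem_erase (ih _ x hx)⟩

theorem serialPicks_pairwise (as : List (Fin n)) (U : Finset (Fin m)) :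
    (I.serialPicks as U).Pairwise I.PickOrder := by
  induction as generalizing U with
  | nil => simp [serialPicks]
  | cons a as ih =>
    unfold serialPicks
    cases hg : I.topItem a U with
    | none => simp
    | some g =>
      refine List.pairwise_cons.2 ⟨fun x hx => ?_, ih _⟩
      have hxU := Finset.mem_erase.1 (I.mem_of_mem_serialPicks _ _ x hx)
      exact ((I.topItem_eq_some_iff.1 hg).2 _ hxU.2).lt_of_ne
        fun h => hxU.1 (descLex_injective _ h).symm

/-- The set of the items that occur in a list of picks. -/
def pickedItems (l : List (Fin n × Fin m)) : Finset (Fin m) := (l.map Prod.snd).toFinset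

theorem mem_pickedItems {l : List (Fin n × Fin m)} {g : Fin m} :
    g ∈ pickedItems l ↔ ∃ a, (a, g) ∈ l := by
  simp [pickedItems]

theorem pickedItems_cons (x : Fin n × Fin m) (l : List (Fin n × Fin m)) :
    pickedItems (x :: l) = insert x.2 (pickedItems l) := by
  simp [pickedItems]

theorem pickedItems_serialPicks (as : List (Fin n)) (U : Finset (Fin m))
    (h : U.card ≤ as.length) : pickedItems (I.serialPicks as U) = U := by
  induction as generalizing U with
  | nil =>
    obtain rfl : U = ∅ := by simpa using h
    simp [serialPicks, pickedItems]
  | cons a as ih =>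
    rcases U.eq_empty_or_nonempty with rfl | hU
    · simp [serialPicks, topItem, pickedItems]
    obtain ⟨g, hg⟩ := I.exists_topItem a hU
    have hgU := (I.topItem_eq_some_iff.1 hg).1
    have hcard : (U.erase g).card ≤ as.length := by
      rw [Finset.card_erase_of_mem hgU]
      simpa using Nat.sub_le_sub_right h 1
    simp only [serialPicks, hg]
    rw [pickedItems_cons, ih _ hcard, Finset.insert_erase hgU]

theorem nodup_map_snd_of_pairwise {l : List (Fin n × Fin m)} (h : l.Pairwise I.PickOrder) :
    (l.map Prod.snd).Nodup :=
  List.pairwise_map.2 (h.imp fun hxy e => hxy.ne (congrArg _ e))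

theorem serialPicks_pickedItems {l : List (Fin n × Fin m)} (h : l.Pairwise I.PickOrder)
    {as : List (Fin n)} (has : l.map Prod.fst <+: as) :
    I.serialPicks as (pickedItems l) = l := by
  induction l generalizing as with
  | nil => cases as <;> simp [serialPicks, topItem, pickedItems]
  | cons x l ih =>
    cases as with
    | nil => simp at has
    | cons a as =>
      rw [List.map_cons, List.cons_prefix_cons] at has
      obtain ⟨rfl, has⟩ := has
      have hx : x.2 ∉ pickedItems l := by
        simpa [pickedItems] using (List.nodup_cons.1 (I.nodup_map_snd_of_pairwise h)).1
      rw [List.pairwise_cons] at h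
      have htop : I.topItem x.1 (pickedItems (x :: l)) = some x.2 := by
        refine I.topItem_eq_some_iff.2 ⟨by simp [pickedItems], fun g hg => ?_⟩
        rw [pickedItems_cons, Finset.mem_insert] at hg
        rcases hg with rfl | hg
        · rfl
        · obtain ⟨b, hb⟩ := mem_pickedItems.1 hg
          exact (h.1 _ hb).le
      simp only [serialPicks, htop]
      rw [pickedItems_cons, Finset.erase_insert hx, ih h.2 has]

/-- The items picked by `a`, in the order of the picks: the column of `a` in the matrix of a
Round-Robin. -/
def column (l : List (Fin n × Fin m)) (a : Fin n) : List (Fin m) :=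
  (l.filter fun x => x.1 = a).map Prod.snd

theorem mem_column {l : List (Fin n × Fin m)} {a : Fin n} {g : Fin m} :
    g ∈ column l a ↔ (a, g) ∈ l := by
  simp [column]

theorem column_append (l l' : List (Fin n × Fin m)) (a : Fin n) :
    column (l ++ l') a = column l a ++ column l' a := by
  simp [column]

theorem column_of_notMem {l : List (Fin n × Fin m)} {a : Fin n} (ha : a ∉ l.map Prod.fst) :
    column l a = [] :=
  List.eq_nil_iff_forall_not_mem.2 fun _ hg =>
    ha (List.mem_map_of_mem (f := Prod.fst) (mem_column.1 hg))

theorem column_of_mem {l : List (Fin n × Fin m)} (h : (l.map Prod.fst).Nodup)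
    {x : Fin n × Fin m} (hx : x ∈ l) : column l x.1 = [x.2] := by
  have hfilter : l.filter (fun y => y.1 = x.1) = l.filter (fun y => y = x) :=
    List.filter_congr fun y hy => decide_eq_decide.2
      ⟨List.inj_on_of_nodup_map h hy hx, congrArg Prod.fst⟩
  rw [column, hfilter, List.filter_eq, List.count_eq_one_of_mem h.of_map hx]
  rfl

theorem column_nodup {l : List (Fin n × Fin m)} (h : l.Pairwise I.PickOrder) (a : Fin n) :
    (column l a).Nodup :=
  (I.nodup_map_snd_of_pairwise h).sublist (List.filter_sublist.map _)

theorem column_pairwise_val_le {l : List (Fin n × Fin m)} (h : l.Pairwise I.PickOrder)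
    (a : Fin n) : (column l a).Pairwise fun g g' => I.val a g' ≤ I.val a g := by
  refine List.pairwise_map.2 ((h.sublist List.filter_sublist).imp_of_mem fun {x y} hx _ hxy => ?_)
  obtain rfl : x.1 = a := by simpa using (List.mem_filter.1 hx).2
  exact hxy.val_le

theorem column_disjoint {l : List (Fin n × Fin m)} (h : l.Pairwise I.PickOrder) {a b : Fin n}
    (hab : a ≠ b) : Disjoint (column l a).toFinset (column l b).toFinset := by
  refine Finset.disjoint_left.2 fun g ha hb => hab ?_
  rw [List.mem_toFinset, mem_column] at ha hb
  exact congrArg Prod.fst (List.inj_on_of_nodup_map (I.nodup_map_snd_of_pairwise h) ha hb rfl)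

/-! ### Round-Robin -/

/-- The list `l` of picks arises when the distinct agents `L` pick cyclically their most preferred
items. This is intrinsic in `l`, so that it can be passed on to sublists of `l`. -/
structure IsRoundRobin (L : List (Fin n)) (l : List (Fin n × Fin m)) : Prop where
  nodup : L.Nodup
  pairwise : l.Pairwise I.PickOrder
  exists_prefix : ∃ N, l.map Prod.fst <+: (List.replicate N L).flatten

theorem isRoundRobin_serialPicks {L : List (Fin n)} (hL : L.Nodup) (N : ℕ)
    (U : Finset (Fin m)) :
    I.IsRoundRobin L (I.serialPicks (List.replicate N L).flatten U) :=
  ⟨hL, I.serialPicks_pairwise _ _, N, I.serialPicks_fst_prefix _ _⟩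

namespace IsRoundRobin

variable {I} {L : List (Fin n)} {l : List (Fin n × Fin m)}

theorem fst_mem (h : I.IsRoundRobin L l) {x : Fin n × Fin m} (hx : x ∈ l) : x.1 ∈ L := by
  obtain ⟨N, hN⟩ := h.exists_prefix
  obtain ⟨L', hL', hxL⟩ := List.mem_flatten.1 (hN.subset (List.mem_map_of_mem hx))
  exact List.eq_of_mem_replicate hL' ▸ hxL

theorem roundRobin_pickedItems (h : I.IsRoundRobin L l) :
    I.roundRobin L (pickedItems l) = column l := by
  obtain ⟨N, hN⟩ := h.exists_prefix
  have hcard : (pickedItems l).card = l.length := by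
    rw [pickedItems, List.toFinset_card_of_nodup (I.nodup_map_snd_of_pairwise h.pairwise),
      List.length_map]
  have hprefix : l.map Prod.fst <+: (List.replicate (pickedItems l).card L).flatten := by
    rcases L.length.eq_zero_or_pos with hL | hL
    · obtain rfl := List.length_eq_zero_iff.1 hL
      simpa using hN
    refine List.prefix_of_prefix_length_le
      (hN.trans (flatten_replicate_prefix _ (le_max_left N (pickedItems l).card)))
      (flatten_replicate_prefix _ (le_max_right N (pickedItems l).card)) ?_
    simp only [List.length_map, List.length_flatten, List.map_replicate, List.sum_replicate,
      smul_eq_mul, hcard]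
    exact Nat.le_mul_of_pos_right _ hL
  ext1 a
  rw [roundRobin, I.serialPicks_pickedItems h.pairwise hprefix, column]

theorem drop (h : I.IsRoundRobin L l) : I.IsRoundRobin L (l.drop L.length) := by
  obtain ⟨N, hN⟩ := h.exists_prefix
  refine ⟨h.nodup, h.pairwise.sublist (List.drop_sublist _ _), N - 1, ?_⟩
  rw [List.map_drop]
  cases N with
  | zero => simp_all
  | succ N => simpa [List.replicate_succ] using hN.drop L.length

theorem take_fst_prefix (h : I.IsRoundRobin L l) : (l.take L.length).map Prod.fst <+: L := by
  obtain ⟨N, hN⟩ := h.exists_prefix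
  rw [List.map_take]
  cases N with
  | zero => simp_all
  | succ N => simpa [List.replicate_succ] using hN.take L.length

theorem fst_eq_of_getElem? (h : I.IsRoundRobin L l) {i p : ℕ} (hp : p < L.length)
    {x : Fin n × Fin m} (hx : l[i * L.length + p]? = some x) : x.1 = L[p] := by
  induction i generalizing l with
  | zero =>
    rw [zero_mul, zero_add] at hx
    obtain ⟨hpl, rfl⟩ := List.getElem?_eq_some_iff.1 hx
    simpa using h.take_fst_prefix.getElem (i := p) (by simp [hp, hpl])
  | succ i ih =>
    refine ih h.drop ?_
    rw [List.getElem?_drop, ← hx]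
    congr 1
    ring

theorem column_eq_cons (h : I.IsRoundRobin L l) {p : ℕ} (hp : p < L.length) (hpl : p < l.length) :
    column l L[p] = l[p].2 :: column (l.drop L.length) L[p] := by
  have hmem : l[p] ∈ l.take L.length := List.mem_take_iff_getElem.2 ⟨p, by omega, rfl⟩
  conv_lhs => rw [← List.take_append_drop L.length l]
  rw [column_append, ← h.fst_eq_of_getElem? (i := 0) (x := l[p]) hp (by simp),
    column_of_mem (h.nodup.sublist h.take_fst_prefix.sublist) hmem, List.singleton_append]

theorem column_eq_nil (h : I.IsRoundRobin L l) {p : ℕ} (hp : p < L.length) (hpl : l.length ≤ p) :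
    column l L[p] = [] := by
  refine column_of_notMem fun hmem => ?_
  have hprefix := h.take_fst_prefix
  rw [List.take_of_length_le (hpl.trans hp.le), List.prefix_iff_eq_take, List.length_map] at hprefix
  rw [hprefix] at hmem
  obtain ⟨q, hq, he⟩ := List.mem_take_iff_getElem.1 hmem
  have := h.nodup.getElem_inj_iff.1 he
  omega

theorem column_drop (h : I.IsRoundRobin L l) {a : Fin n} (ha : a ∈ L) :
    column (l.drop L.length) a = (column l a).drop 1 := by
  obtain ⟨p, hp, rfl⟩ := List.getElem_of_mem ha
  rcases lt_or_ge p l.length with hpl | hpl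
  · rw [h.column_eq_cons hp hpl, List.drop_one, List.tail_cons]
  · rw [h.column_eq_nil hp hpl, List.drop_eq_nil_of_le (by omega)]
    rfl

theorem getElem?_column (h : I.IsRoundRobin L l) {p : ℕ} (hp : p < L.length) (j : ℕ) :
    (column l L[p])[j]? = l[j * L.length + p]?.map Prod.snd := by
  induction j generalizing l with
  | zero =>
    rcases lt_or_ge p l.length with hpl | hpl
    · simp [h.column_eq_cons hp hpl, hpl]
    · simp [h.column_eq_nil hp hpl, hpl]
  | succ j ih =>
    have hj := ih h.drop
    rw [h.column_drop (List.getElem_mem hp), List.getElem?_drop, List.getElem?_drop] at hj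
    rw [add_comm j, hj]
    congr 2
    ring

theorem pickedItems_eq_biUnion (h : I.IsRoundRobin L l) :
    pickedItems l = L.toFinset.biUnion fun a => (column l a).toFinset := by
  ext g
  simp only [mem_pickedItems, Finset.mem_biUnion, List.mem_toFinset, mem_column]
  exact exists_congr fun a => ⟨fun ha => ⟨h.fst_mem ha, ha⟩, And.right⟩

end IsRoundRobin

/-- Agent `a` likes the `j`-th entry of `x` at least as much as the `j`-th entry of `y`, for
all `j`. This compares the columns of a Round-Robin row by row. -/
def RowDominates (a : Fin n) (x y : List (Fin m)) : Prop :=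
  ∀ (j : ℕ) (h : Fin m), y[j]? = some h → ∃ g, x[j]? = some g ∧ I.val a h ≤ I.val a g

variable {I} in
theorem RowDominates.drop {a : Fin n} {x y : List (Fin m)} (h : I.RowDominates a x y) (k : ℕ) :
    I.RowDominates a (x.drop k) (y.drop k) := by
  intro j
  rw [List.getElem?_drop, List.getElem?_drop]
  exact h _

variable {I} in
theorem RowDominates.take {a : Fin n} {x y : List (Fin m)} (h : I.RowDominates a x y) (k : ℕ) :
    I.RowDominates a (x.take k) (y.take k) := by
  intro j
  rw [List.getElem?_take, List.getElem?_take]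
  split_ifs
  · exact h _
  · simp

namespace IsRoundRobin

variable {I} {L : List (Fin n)} {l : List (Fin n × Fin m)}

theorem exists_getElem?_column (h : I.IsRoundRobin L l) {p q i j : ℕ} (hp : p < L.length)
    (hq : q < L.length) (hlt : i * L.length + p < j * L.length + q) {y : Fin m}
    (hy : (column l L[q])[j]? = some y) :
    ∃ g, (column l L[p])[i]? = some g ∧ I.val L[p] y ≤ I.val L[p] g := by
  rw [h.getElem?_column hq, Option.map_eq_some_iff] at hy
  obtain ⟨y, hy, rfl⟩ := hy
  obtain ⟨hj, rfl⟩ := List.getElem?_eq_some_iff.1 hy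
  have hi := List.getElem?_eq_getElem (hlt.trans hj)
  refine ⟨_, by rw [h.getElem?_column hp, hi, Option.map_some], ?_⟩
  exact h.fst_eq_of_getElem? hp hi ▸ (List.pairwise_iff_getElem.1 h.pairwise _ _ _ hj hlt).val_le

theorem pairwise_rowDominates (h : I.IsRoundRobin L l) :
    L.Pairwise fun a b => I.RowDominates a (column l a) (column l b) := by
  refine List.pairwise_iff_getElem.2 fun p q hp hq hpq j y hy => ?_
  exact h.exists_getElem?_column hp hq (by omega) hy

theorem rowDominates_drop_one (h : I.IsRoundRobin L l) {a b : Fin n} (ha : a ∈ L) (hb : b ∈ L) :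
    I.RowDominates a (column l a) ((column l b).drop 1) := by
  obtain ⟨p, hp, rfl⟩ := List.getElem_of_mem ha
  obtain ⟨q, hq, rfl⟩ := List.getElem_of_mem hb
  intro j y hy
  rw [List.getElem?_drop] at hy
  exact h.exists_getElem?_column hp hq (by nlinarith) hy

end IsRoundRobin

/-! ### Values of columns -/

theorem value_nonneg (a : Fin n) (S : Finset (Fin m)) : 0 ≤ I.value a S :=
  Finset.sum_nonneg fun g _ => I.nonneg a g

theorem value_mono (a : Fin n) {S T : Finset (Fin m)} (h : S ⊆ T) : I.value a S ≤ I.value a T :=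
  Finset.sum_le_sum_of_subset_of_nonneg h fun g _ _ => I.nonneg a g

theorem value_union_le (a : Fin n) (S T : Finset (Fin m)) :
    I.value a (S ∪ T) ≤ I.value a S + I.value a T := by
  have hinter : I.value a (S ∪ T) + I.value a (S ∩ T) = I.value a S + I.value a T :=
    Finset.sum_union_inter
  linarith [I.value_nonneg a (S ∩ T)]

theorem value_le_card (a : Fin n) (S : Finset (Fin m)) : I.value a S ≤ S.card :=
  (Finset.sum_le_card_nsmul S (I.val a) 1 fun g _ => I.le_one a g).trans_eq (by simp)

theorem value_toFinset_le_drop_add (a : Fin n) (x : List (Fin m)) (k : ℕ) :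
    I.value a x.toFinset ≤ I.value a (x.drop k).toFinset + k := by
  have htake : I.value a (x.take k).toFinset ≤ k :=
    (I.value_le_card a _).trans
      (by exact_mod_cast (List.toFinset_card_le _).trans (List.length_take_le _ _))
  calc I.value a x.toFinset
      = I.value a ((x.take k).toFinset ∪ (x.drop k).toFinset) := by
        rw [← List.toFinset_append, List.take_append_drop]
    _ ≤ I.value a (x.take k).toFinset + I.value a (x.drop k).toFinset := I.value_union_le a _ _
    _ ≤ I.value a (x.drop k).toFinset + k := by linarith

theorem value_toFinset (a : Fin n) {x : List (Fin m)} (hx : x.Nodup) :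
    I.value a x.toFinset = (x.map (I.val a)).sum :=
  List.sum_toFinset _ hx

variable {I} in
theorem RowDominates.sum_le {a : Fin n} {x y : List (Fin m)} (h : I.RowDominates a x y) :
    (y.map (I.val a)).sum ≤ (x.map (I.val a)).sum := by
  induction y generalizing x with
  | nil =>
    rw [List.map_nil, List.sum_nil]
    exact List.sum_nonneg (List.forall_mem_map.2 fun g _ => I.nonneg a g)
  | cons u y ih =>
    obtain ⟨g, hg, hle⟩ := h 0 u rfl
    obtain ⟨x, rfl⟩ : ∃ x', x = g :: x' := List.head?_eq_some_iff.1 (List.head?_eq_getElem? ▸ hg)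
    simpa using add_le_add hle (ih (h.drop 1))

variable {I} in
theorem RowDominates.value_le {a : Fin n} {x y : List (Fin m)} (h : I.RowDominates a x y)
    (hx : x.Nodup) (hy : y.Nodup) : I.value a y.toFinset ≤ I.value a x.toFinset := by
  rw [I.value_toFinset a hx, I.value_toFinset a hy]
  exact h.sum_le

theorem IsRoundRobin.value_column_le_add_one {I : FairInstance n m} {L : List (Fin n)}
    {l : List (Fin n × Fin m)} (h : I.IsRoundRobin L l) {a b : Fin n} (ha : a ∈ L) (hb : b ∈ L) :
    I.value a (column l b).toFinset ≤ I.value a (column l a).toFinset + 1 := by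
  have hnd := I.column_nodup h.pairwise
  have hrows := (h.rowDominates_drop_one ha hb).value_le (hnd a) (hnd b).drop
  have hfirst := I.value_toFinset_le_drop_add a (column l b) 1
  rw [Nat.cast_one] at hfirst
  linarith

theorem IsRoundRobin.share_sub_one_lt_value_column {I : FairInstance n m} {L : List (Fin n)}
    {l : List (Fin n × Fin m)} (h : I.IsRoundRobin L l) {a : Fin n} (ha : a ∈ L) :
    I.value a (pickedItems l) / L.length - 1 < I.value a (column l a).toFinset := by
  have hL : (0 : ℝ) < L.length := by exact_mod_cast List.length_pos_of_mem ha
  have hlt : I.value a (pickedItems l) < L.length * (I.value a (column l a).toFinset + 1) :=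
    calc I.value a (pickedItems l)
        = ∑ b ∈ L.toFinset, I.value a (column l b).toFinset := by
          rw [h.pickedItems_eq_biUnion]
          exact Finset.sum_biUnion fun b _ c _ hbc => I.column_disjoint h.pairwise hbc
      _ < ∑ _b ∈ L.toFinset, (I.value a (column l a).toFinset + 1) :=
          Finset.sum_lt_sum
            (fun b hb => h.value_column_le_add_one ha (List.mem_toFinset.1 hb))
            ⟨a, List.mem_toFinset.2 ha, lt_add_one _⟩
      _ = L.length * (I.value a (column l a).toFinset + 1) := by
          rw [Finset.sum_const, List.toFinset_card_of_nodup h.nodup, nsmul_eq_mul]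
  rw [sub_lt_iff_lt_add, div_lt_iff₀ hL]
  linarith

/-- The list `x` of items has at least two entries, and agent `a` values the first two of them
positively. For the own column of `a` this makes every part that misses the first entry worse. -/
def TopTwoPositive (a : Fin n) (x : List (Fin m)) : Prop :=
  ∃ g h t, x = g :: h :: t ∧ 0 < I.val a g ∧ 0 < I.val a h

variable {I} in
theorem TopTwoPositive.value_take_add_drop_lt {a : Fin n} {x : List (Fin m)}
    (h : I.TopTwoPositive a x) (hx : x.Nodup) :
    I.value a (x.take 1).toFinset + I.value a (x.drop 2).toFinset < I.value a x.toFinset := by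
  obtain ⟨g, g', t, rfl, -, hg'⟩ := h
  rw [I.value_toFinset a hx, I.value_toFinset a (hx.sublist (List.take_sublist _ _)),
    I.value_toFinset a (hx.sublist (List.drop_sublist _ _))]
  simpa using hg'

variable {I} in
theorem TopTwoPositive.value_drop_one_lt {a : Fin n} {x : List (Fin m)}
    (h : I.TopTwoPositive a x) (hx : x.Nodup) :
    I.value a (x.drop 1).toFinset < I.value a x.toFinset := by
  obtain ⟨g, g', t, rfl, hg, -⟩ := h
  rw [I.value_toFinset a hx, I.value_toFinset a (hx.sublist (List.drop_sublist _ _))]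
  simpa using hg

theorem topTwoPositive_of_one_lt {a : Fin n} {x : List (Fin m)}
    (hx : x.Pairwise fun g h => I.val a h ≤ I.val a g) (h : 1 < I.value a x.toFinset) :
    I.TopTwoPositive a x := by
  rcases x with _ | ⟨g, x⟩
  · norm_num [value] at h
  have hpos : 0 < I.value a x.toFinset := by
    have hfirst := I.value_toFinset_le_drop_add a (g :: x) 1
    rw [Nat.cast_one] at hfirst
    exact pos_of_lt_add_left (h.trans_le hfirst)
  rcases x with _ | ⟨g', t⟩
  · simp [value] at hpos
  simp only [List.pairwise_cons, List.forall_mem_cons] at hx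
  have hg' : 0 < I.val a g' := by
    by_contra! hle
    refine hpos.not_ge (Finset.sum_nonpos fun u hu => ?_)
    rcases List.mem_cons.1 (List.mem_toFinset.1 hu) with rfl | hu
    · exact hle
    · exact (hx.2.1 u hu).trans hle
  exact ⟨g, g', t, rfl, hg'.trans_le hx.1.1, hg'⟩

variable {I} in
theorem IsRational.eq_of_forall_lt {c : Choice n m} (hc : I.IsRational c) {a : Fin n}
    {avail : Finset (Fin n)} {P : Parts n m} (ha : a ∈ avail)
    (h : ∀ q ∈ avail, q ≠ a → I.value a (P q) < I.value a (P a)) : c a avail P = a := by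
  obtain ⟨hmem, hmax⟩ := hc a avail P ⟨a, ha⟩
  by_contra hne
  exact (h _ hmem hne).not_ge (hmax a ha)

/-! ### Passing to a later stage -/

/-- The picks from the third round on of the agents `L.drop k`, who are left to the later stages
if `k` agents depart. -/
def laterPicks (L : List (Fin n)) (k : ℕ) (l : List (Fin n × Fin m)) : List (Fin n × Fin m) :=
  ((l.drop L.length).drop L.length).filter fun x => x.1 ∈ L.drop k

namespace IsRoundRobin

variable {I} {L : List (Fin n)} {l : List (Fin n × Fin m)}

theorem laterPicks (h : I.IsRoundRobin L l) (k : ℕ) :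
    I.IsRoundRobin (L.drop k) (FairInstance.laterPicks L k l) := by
  have hdrop := h.drop.drop
  obtain ⟨N, hN⟩ := hdrop.exists_prefix
  refine ⟨h.nodup.drop, hdrop.pairwise.sublist List.filter_sublist, N, ?_⟩
  have hfilter := hN.filter (fun a => a ∈ L.drop k)
  rwa [List.filter_map, List.filter_flatten, List.map_replicate,
    filter_mem_drop h.nodup] at hfilter

theorem column_laterPicks (h : I.IsRoundRobin L l) {k : ℕ} {a : Fin n} (ha : a ∈ L.drop k) :
    column (FairInstance.laterPicks L k l) a = (column l a).drop 2 := by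
  have haL : a ∈ L := List.mem_of_mem_drop ha
  calc column (FairInstance.laterPicks L k l) a
      = column ((l.drop L.length).drop L.length) a := by
        unfold column FairInstance.laterPicks
        rw [List.filter_filter]
        congr 1
        refine List.filter_congr fun x _ => ?_
        by_cases hx : x.1 = a <;> simp [hx, ha]
    _ = (column l a).drop 2 := by
        rw [h.drop.column_drop haL, h.column_drop haL, List.drop_drop]

theorem value_column_le_value_column_laterPicks_add_two (h : I.IsRoundRobin L l) {k : ℕ}
    {a : Fin n} (ha : a ∈ L.drop k) :
    I.value a (column l a).toFinset ≤
      I.value a (column (FairInstance.laterPicks L k l) a).toFinset + 2 := by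
  rw [h.column_laterPicks ha]
  exact_mod_cast I.value_toFinset_le_drop_add a (column l a) 2

theorem pickedItems_laterPicks (h : I.IsRoundRobin L l) (k : ℕ) :
    pickedItems (FairInstance.laterPicks L k l) =
      (L.drop k).toFinset.biUnion fun d => ((column l d).drop 2).toFinset := by
  rw [(h.laterPicks k).pickedItems_eq_biUnion]
  exact Finset.biUnion_congr rfl fun d hd => by rw [h.column_laterPicks (List.mem_toFinset.1 hd)]

end IsRoundRobin

end FairInstance

namespace BoundedProp

open FairInstance

variable {n m : ℕ}

/-! ### Transfers and swaps -/

theorem mem_transfer_self {P : Parts n m} {S : Finset (Fin m)} {a : Fin n} {g : Fin m} :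
    g ∈ transfer P S a a ↔ g ∈ P a ∨ g ∈ S := by
  simp [transfer]

theorem subset_transfer_self (P : Parts n m) (S : Finset (Fin m)) (a : Fin n) :
    P a ⊆ transfer P S a a :=
  fun _ hg => mem_transfer_self.2 (Or.inl hg)

theorem transfer_of_ne {P : Parts n m} {S : Finset (Fin m)} {a q : Fin n} (h : q ≠ a) :
    transfer P S a q = P q \ S := by
  simp [transfer, h]

theorem transfer_empty (P : Parts n m) (a : Fin n) : transfer P ∅ a = P := by
  ext1 q
  simp [transfer]

section Swaps

variable {R : Fin n → List (Fin m)} {P : Parts n m}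

theorem cell_zero (R : Fin n → List (Fin m)) (P : Parts n m) (a : Fin n) :
    cell R P 0 a = ((R a).take 1).toFinset ∩ P a := by
  rw [cell]
  cases R a <;> simp

theorem mem_donorItems {avail : Finset (Fin n)} {donors : List (Fin n)} {g : Fin m} :
    g ∈ donorItems R P avail donors ↔
      ∃ d ∈ donors, d ∈ avail ∧ g ∈ (R d).take 2 ∧ g ∈ P d := by
  have htake (x : List (Fin m)) : g ∈ x.take 2 ↔ x[0]? = some g ∨ x[1]? = some g := by
    rcases x with _ | ⟨u, _ | ⟨v, t⟩⟩ <;> simp [eq_comm]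
  simp only [donorItems, cell, Finset.mem_biUnion, Finset.mem_inter, List.mem_toFinset,
    Finset.mem_union, Option.mem_toFinset, Option.mem_def, htake, or_and_right, and_assoc]

theorem swapTop_of_ne {b d q : Fin n} (hb : q ≠ b) (hd : q ≠ d) :
    swapTop R P b d q = (P q \ cell R P 0 b) \ cell R P 0 d := by
  rw [swapTop, transfer_of_ne hb, transfer_of_ne hd]

theorem swapTop_subset {b d q : Fin n} (hb : q ≠ b) (hd : q ≠ d) : swapTop R P b d q ⊆ P q := by
  rw [swapTop_of_ne hb hd]
  exact Finset.sdiff_subset.trans Finset.sdiff_subset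

theorem swapTop_fst_subset {b d : Fin n} (h : b ≠ d) :
    swapTop R P b d b ⊆ (P b \ ((R b).take 1).toFinset) ∪ (((R d).take 1).toFinset ∩ P d) := by
  intro g hg
  rw [swapTop, mem_transfer_self, transfer_of_ne h, cell_zero, cell_zero] at hg
  simp only [Finset.mem_sdiff, Finset.mem_inter, Finset.mem_union] at hg ⊢
  tauto

theorem swapTop_snd_subset {b d : Fin n} (h : b ≠ d) :
    swapTop R P b d d ⊆ P d ∪ ((R b).take 1).toFinset := by
  intro g hg
  rw [swapTop, transfer_of_ne h.symm, Finset.mem_sdiff, mem_transfer_self, cell_zero] at hg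
  exact Finset.mem_union.2 (hg.1.imp_right Finset.mem_of_mem_inter_left)

/-- The top entries of all pairs of columns in the list are swapped, one pair after the other: the
rebundled partition when all these columns are unpicked. -/
def swapAll (R : Fin n → List (Fin m)) (pairs : List (Fin n × Fin n)) (P : Parts n m) :
    Parts n m :=
  pairs.foldl (fun Q x => swapTop R Q x.1 x.2) P

theorem swapAll_subset {pairs : List (Fin n × Fin n)} {q : Fin n}
    (h1 : q ∉ pairs.map Prod.fst) (h2 : q ∉ pairs.map Prod.snd) :
    swapAll R pairs P q ⊆ P q := by
  induction pairs generalizing P with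
  | nil => exact subset_rfl
  | cons x pairs ih =>
    rw [List.map_cons, List.mem_cons, not_or] at h1 h2
    exact (ih h1.2 h2.2).trans (swapTop_subset h1.1 h2.1)

theorem swapAll_of_disjoint {pairs : List (Fin n × Fin n)} {q : Fin n}
    (h : ∀ b ∈ pairs.map Prod.fst ++ pairs.map Prod.snd,
      q ≠ b ∧ Disjoint (P q) ((R b).take 1).toFinset) :
    swapAll R pairs P q = P q := by
  induction pairs generalizing P with
  | nil => rfl
  | cons x pairs ih =>
    have hsdiff (Q : Finset (Fin m)) {b : Fin n} (hb : Disjoint (P q) ((R b).take 1).toFinset) :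
        P q \ (((R b).take 1).toFinset ∩ Q) = P q :=
      Finset.sdiff_eq_self_of_disjoint (hb.mono_right Finset.inter_subset_left)
    obtain ⟨hne1, hdisj1⟩ := h x.1 (by simp)
    obtain ⟨hne2, hdisj2⟩ := h x.2 (by simp)
    have hx : swapTop R P x.1 x.2 q = P q := by
      rw [swapTop_of_ne hne1 hne2, cell_zero, cell_zero, hsdiff _ hdisj1, hsdiff _ hdisj2]
    refine (ih (P := swapTop R P x.1 x.2) fun b hb => ?_).trans hx
    rw [hx]
    exact h b (List.mem_append.2 ((List.mem_append.1 hb).imp (List.mem_cons_of_mem _)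
      (List.mem_cons_of_mem _)))

theorem swapAll_pair_subset {pairs : List (Fin n × Fin n)}
    (h : (pairs.map Prod.fst ++ pairs.map Prod.snd).Nodup) {b d : Fin n} (hbd : (b, d) ∈ pairs) :
    swapAll R pairs P b ⊆ (P b \ ((R b).take 1).toFinset) ∪ (((R d).take 1).toFinset ∩ P d) ∧
      swapAll R pairs P d ⊆ P d ∪ ((R b).take 1).toFinset := by
  induction pairs generalizing P with
  | nil => simp at hbd
  | cons x pairs ih =>
    rw [List.map_cons, List.map_cons, List.cons_append, List.nodup_cons,
      List.perm_middle.nodup_iff, List.nodup_cons] at h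
    simp only [List.mem_append, List.mem_cons, not_or] at h
    obtain ⟨⟨hx1, hx12, hx1'⟩, ⟨hx2, hx2'⟩, hnd⟩ := h
    rcases List.mem_cons.1 hbd with rfl | hbd
    · exact ⟨(swapAll_subset hx1 hx1').trans (swapTop_fst_subset hx12),
        (swapAll_subset hx2 hx2').trans (swapTop_snd_subset hx12)⟩
    · have hb1 : b ∈ pairs.map Prod.fst := List.mem_map_of_mem (f := Prod.fst) hbd
      have hd2 : d ∈ pairs.map Prod.snd := List.mem_map_of_mem (f := Prod.snd) hbd
      have hb : swapTop R P x.1 x.2 b ⊆ P b :=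
        swapTop_subset (ne_of_mem_of_not_mem hb1 hx1) (ne_of_mem_of_not_mem hb1 hx2)
      have hd : swapTop R P x.1 x.2 d ⊆ P d :=
        swapTop_subset (ne_of_mem_of_not_mem hd2 hx1') (ne_of_mem_of_not_mem hd2 hx2')
      obtain ⟨ih1, ih2⟩ := ih (P := swapTop R P x.1 x.2) hnd hbd
      exact ⟨ih1.trans (by gcongr), ih2.trans (by gcongr)⟩

end Swaps

/-! ### The arrival of an agent -/

/-- What the columns `R` of Round-Robin provide to the rest of a stage in which the agents `as` are
still to arrive, in this order, and the agents `donors` are left to the later stages. -/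
structure IsStageMatrix (I : FairInstance n m) (R : Fin n → List (Fin m))
    (as donors : List (Fin n)) : Prop where
  nodup : (as ++ donors).Nodup
  column_nodup : ∀ q, (R q).Nodup
  disjoint : ∀ p q, p ≠ q → Disjoint (R p).toFinset (R q).toFinset
  rowDominates : (as ++ donors).Pairwise fun a b => I.RowDominates a (R a) (R b)
  length_le : as.length ≤ donors.length + 1

/-- The invariant of a stage as long as everybody takes their own part: the agents in `as`, who are
still to arrive, have their full columns, and the donors have lost at most items of the top two
rows. -/
structure StageInvariant (R : Fin n → List (Fin m)) (as donors : List (Fin n))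
    (s : StageState n m) : Prop where
  avail_eq : s.avail = (as ++ donors).toFinset
  parts_eq : ∀ q ∈ as, s.parts q = (R q).toFinset
  parts_subset : ∀ d ∈ donors, s.parts d ⊆ (R d).toFinset
  subset_parts : ∀ d ∈ donors, ((R d).drop 2).toFinset ⊆ s.parts d

section Arrival

variable {I : FairInstance n m} {c : Choice n m} {R : Fin n → List (Fin m)}
  {as donors later : List (Fin n)} {a : Fin n} {s : StageState n m}

theorem IsStageMatrix.tail (h : IsStageMatrix I R (a :: later) donors) :
    IsStageMatrix I R later donors where
  nodup := (List.nodup_cons.1 h.nodup).2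
  column_nodup := h.column_nodup
  disjoint := h.disjoint
  rowDominates := (List.pairwise_cons.1 h.rowDominates).2
  length_le := (Nat.le_succ _).trans h.length_le

theorem IsStageMatrix.notMem (h : IsStageMatrix I R (a :: later) donors) :
    a ∉ later ++ donors :=
  (List.nodup_cons.1 h.nodup).1

theorem IsStageMatrix.rowDominates_head (h : IsStageMatrix I R (a :: later) donors) {q : Fin n}
    (hq : q ∈ later ++ donors) : I.RowDominates a (R a) (R q) :=
  (List.pairwise_cons.1 h.rowDominates).1 q hq

theorem IsStageMatrix.value_drop_le (h : IsStageMatrix I R (a :: later) donors) {q : Fin n}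
    (hq : q ∈ later ++ donors) (k : ℕ) :
    I.value a ((R q).drop k).toFinset ≤ I.value a ((R a).drop k).toFinset :=
  ((h.rowDominates_head hq).drop k).value_le (h.column_nodup a).drop (h.column_nodup q).drop

theorem IsStageMatrix.value_take_le (h : IsStageMatrix I R (a :: later) donors) {q : Fin n}
    (hq : q ∈ later ++ donors) (k : ℕ) :
    I.value a ((R q).take k).toFinset ≤ I.value a ((R a).take k).toFinset :=
  ((h.rowDominates_head hq).take k).value_le (h.column_nodup a).take (h.column_nodup q).take

namespace StageInvariant

theorem mem_avail (hs : StageInvariant R (a :: later) donors s) {q : Fin n} :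
    q ∈ s.avail ↔ q = a ∨ q ∈ later ++ donors := by
  rw [hs.avail_eq, List.cons_append, List.toFinset_cons, Finset.mem_insert, List.mem_toFinset]

theorem parts_subset_column (hs : StageInvariant R as donors s) {q : Fin n}
    (hq : q ∈ as ++ donors) : s.parts q ⊆ (R q).toFinset :=
  (List.mem_append.1 hq).elim (fun h => (hs.parts_eq q h).subset) (hs.parts_subset q)

theorem disjoint_donorItems (hs : StageInvariant R as donors s) (h : IsStageMatrix I R as donors)
    {q : Fin n} (hq : q ∉ donors) :
    Disjoint (R q).toFinset (donorItems R s.parts s.avail donors) := by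
  refine Finset.disjoint_left.2 fun g hg hgD => ?_
  obtain ⟨d, hd, -, -, hgd⟩ := mem_donorItems.1 hgD
  exact Finset.disjoint_left.1 (h.disjoint q d (ne_of_mem_of_not_mem hd hq).symm) hg
    (hs.parts_subset d hd hgd)

theorem parts_sdiff_donorItems (hs : StageInvariant R as donors s)
    (h : IsStageMatrix I R as donors) {d : Fin n} (hd : d ∈ donors) :
    s.parts d \ donorItems R s.parts s.avail donors = ((R d).drop 2).toFinset := by
  have hdav : d ∈ s.avail := by simp [hs.avail_eq, hd]
  ext g
  rw [Finset.mem_sdiff, mem_donorItems, List.mem_toFinset]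
  constructor
  · rintro ⟨hg, hnot⟩
    have hgR := List.mem_toFinset.1 (hs.parts_subset d hd hg)
    rw [← List.take_append_drop 2 (R d), List.mem_append] at hgR
    exact hgR.resolve_left fun htake => hnot ⟨d, hd, hdav, htake, hg⟩
  · intro hg
    refine ⟨hs.subset_parts d hd (List.mem_toFinset.2 hg), fun ⟨d', _, _, htake, _⟩ => ?_⟩
    obtain rfl : d' = d := by
      by_contra hne
      exact Finset.disjoint_left.1 (h.disjoint d' d hne)
        (List.mem_toFinset.2 (List.mem_of_mem_take htake))
        (List.mem_toFinset.2 (List.mem_of_mem_drop hg))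
    exact List.disjoint_take_drop (h.column_nodup d') le_rfl htake hg

end StageInvariant

theorem choice_last (hc : I.IsRational c) (h : IsStageMatrix I R [a] donors)
    (hs : StageInvariant R [a] donors s) (ha : I.TopTwoPositive a (R a)) :
    c a s.avail (transfer s.parts (donorItems R s.parts s.avail donors) a) = a := by
  refine hc.eq_of_forall_lt (hs.mem_avail.2 (Or.inl rfl)) fun q hq hqa => ?_
  have hqd : q ∈ donors := (hs.mem_avail.1 hq).resolve_left hqa
  have hdrop : I.value a ((R a).drop 2).toFinset < I.value a (R a).toFinset := by
    linarith [ha.value_take_add_drop_lt (h.column_nodup a),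
      I.value_nonneg a ((R a).take 1).toFinset]
  calc I.value a (transfer s.parts (donorItems R s.parts s.avail donors) a q)
      = I.value a ((R q).drop 2).toFinset := by
        rw [transfer_of_ne hqa, hs.parts_sdiff_donorItems h hqd]
    _ ≤ I.value a ((R a).drop 2).toFinset := h.value_drop_le hqd 2
    _ < I.value a (R a).toFinset := hdrop
    _ ≤ _ := I.value_mono a (hs.parts_eq a (by simp) ▸ subset_transfer_self _ _ _)

theorem choice_donated (hc : I.IsRational c) (h : IsStageMatrix I R (a :: later) donors)
    (hs : StageInvariant R (a :: later) donors s) {g : Fin m}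
    (hg : g ∈ donorItems R s.parts s.avail donors) (hpos : 0 < I.val a g) :
    c a s.avail (transfer s.parts {g} a) = a := by
  refine hc.eq_of_forall_lt (hs.mem_avail.2 (Or.inl rfl)) fun q hq hqa => ?_
  have hq' : q ∈ later ++ donors := (hs.mem_avail.1 hq).resolve_left hqa
  have hga : g ∉ (R a).toFinset := fun hga => Finset.disjoint_left.1
    (hs.disjoint_donorItems h fun hd => h.notMem (List.mem_append_right _ hd)) hga hg
  have hown : transfer s.parts {g} a a = insert g (R a).toFinset := by
    rw [transfer, if_pos rfl, hs.parts_eq a (by simp), Finset.union_singleton]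
  calc I.value a (transfer s.parts {g} a q)
      ≤ I.value a (R q).toFinset := by
        rw [transfer_of_ne hqa]
        exact I.value_mono a
          (Finset.sdiff_subset.trans (hs.parts_subset_column (List.mem_cons_of_mem _ hq')))
    _ ≤ I.value a (R a).toFinset := h.value_drop_le hq' 0
    _ < I.val a g + I.value a (R a).toFinset := lt_add_of_pos_left _ hpos
    _ = I.value a (transfer s.parts {g} a a) := by rw [hown]; exact (Finset.sum_insert hga).symm

theorem rebundle_eq_swapAll (hs : StageInvariant R (a :: later) donors s) :
    rebundle R s.parts s.avail (later.zip donors) = swapAll R (later.zip donors) s.parts := by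
  rw [rebundle, swapAll, List.filter_eq_self.2]
  intro x hx
  have hx' := List.of_mem_zip (a := x.1) (b := x.2) hx
  simp [hs.avail_eq, hx'.1, hx'.2]

theorem IsStageMatrix.nodup_zip (h : IsStageMatrix I R (a :: later) donors) :
    ((later.zip donors).map Prod.fst ++ (later.zip donors).map Prod.snd).Nodup := by
  have hlen : later.length ≤ donors.length := Nat.le_of_succ_le_succ h.length_le
  have hsnd : (later.zip donors).map Prod.snd = donors.take later.length :=
    List.ext_getElem (by simp) (by simp)
  rw [List.map_fst_zip hlen, hsnd]
  exact h.tail.nodup.sublist ((List.take_sublist _ _).append_left later)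

theorem StageInvariant.swapAll_self (hs : StageInvariant R (a :: later) donors s)
    (h : IsStageMatrix I R (a :: later) donors) :
    swapAll R (later.zip donors) s.parts a = s.parts a := by
  refine swapAll_of_disjoint fun b hb => ?_
  have hb' : b ∈ later ++ donors := by
    rw [List.mem_append, List.mem_map, List.mem_map] at hb
    rcases hb with ⟨x, hx, rfl⟩ | ⟨x, hx, rfl⟩
    · exact List.mem_append_left _ (List.of_mem_zip (a := x.1) (b := x.2) hx).1
    · exact List.mem_append_right _ (List.of_mem_zip (a := x.1) (b := x.2) hx).2
  have hab : a ≠ b := (ne_of_mem_of_not_mem hb' h.notMem).symm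
  rw [hs.parts_eq a (by simp)]
  refine ⟨hab, (h.disjoint a b hab).mono_right fun g hg => ?_⟩
  exact List.mem_toFinset.2 (List.mem_of_mem_take (List.mem_toFinset.1 hg))

theorem StageInvariant.swapAll_later_subset (hs : StageInvariant R (a :: later) donors s)
    (h : IsStageMatrix I R (a :: later) donors) {b : Fin n} (hb : b ∈ later) :
    swapAll R (later.zip donors) s.parts b ⊆
      ((R b).drop 1).toFinset ∪ donorItems R s.parts s.avail donors := by
  have hlen : later.length ≤ donors.length := Nat.le_of_succ_le_succ h.length_le
  obtain ⟨⟨_, d⟩, hbd, rfl⟩ : ∃ x ∈ later.zip donors, x.1 = b :=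
    List.mem_map.1 (by rwa [List.map_fst_zip hlen])
  have hd : d ∈ donors := (List.of_mem_zip hbd).2
  refine (swapAll_pair_subset h.nodup_zip hbd).1.trans (Finset.union_subset_union ?_ ?_)
  · intro g hg
    rw [hs.parts_eq _ (List.mem_cons_of_mem _ hb), Finset.mem_sdiff, List.mem_toFinset,
      List.mem_toFinset] at hg
    have hg' := hg.1
    rw [← List.take_append_drop 1 (R _), List.mem_append] at hg'
    exact List.mem_toFinset.2 (hg'.resolve_left hg.2)
  · intro g hg
    rw [Finset.mem_inter, List.mem_toFinset] at hg
    exact mem_donorItems.2 ⟨d, hd, hs.mem_avail.2 (Or.inr (List.mem_append_right _ hd)),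
      List.take_subset_take_left _ one_le_two hg.1, hg.2⟩

theorem StageInvariant.value_parts_donor_le (hs : StageInvariant R (a :: later) donors s)
    (h : IsStageMatrix I R (a :: later) donors)
    (hD : I.value a (donorItems R s.parts s.avail donors) = 0) {d : Fin n} (hd : d ∈ donors) :
    I.value a (s.parts d) ≤ I.value a ((R a).drop 2).toFinset := by
  set D := donorItems R s.parts s.avail donors
  calc I.value a (s.parts d)
      ≤ I.value a (((R d).drop 2).toFinset ∪ D) := by
        rw [← hs.parts_sdiff_donorItems h hd, Finset.sdiff_union_self_eq_union]
        exact I.value_mono a Finset.subset_union_left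
    _ ≤ I.value a ((R d).drop 2).toFinset + I.value a D := I.value_union_le a _ _
    _ = I.value a ((R d).drop 2).toFinset := by rw [hD, add_zero]
    _ ≤ _ := h.value_drop_le (List.mem_append_right _ hd) 2

theorem StageInvariant.value_swapAll_donor_lt (hs : StageInvariant R (a :: later) donors s)
    (h : IsStageMatrix I R (a :: later) donors) (ha : I.TopTwoPositive a (R a))
    (hD : I.value a (donorItems R s.parts s.avail donors) = 0) {d : Fin n} (hd : d ∈ donors) :
    I.value a (swapAll R (later.zip donors) s.parts d) < I.value a (R a).toFinset := by
  have hparts := hs.value_parts_donor_le h hD hd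
  have htwo := ha.value_take_add_drop_lt (h.column_nodup a)
  by_cases hsnd : d ∈ (later.zip donors).map Prod.snd
  · obtain ⟨⟨b, e⟩, hbd, he⟩ := List.mem_map.1 hsnd
    obtain rfl : e = d := he
    have hb : b ∈ later ++ donors := List.mem_append_left _ (List.of_mem_zip hbd).1
    have hswap := I.value_mono a (swapAll_pair_subset (R := R) (P := s.parts) h.nodup_zip hbd).2
    linarith [I.value_union_le a (s.parts e) ((R b).take 1).toFinset, h.value_take_le hb 1]
  · have hfst : d ∉ (later.zip donors).map Prod.fst := fun hmem => by
      obtain ⟨⟨_, e⟩, hx, rfl⟩ := List.mem_map.1 hmem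
      exact List.disjoint_of_nodup_append h.tail.nodup (List.of_mem_zip hx).1 hd
    linarith [I.value_mono a (swapAll_subset (R := R) (P := s.parts) hfst hsnd),
      I.value_nonneg a ((R a).take 1).toFinset]

theorem choice_rebundle (hc : I.IsRational c) (h : IsStageMatrix I R (a :: later) donors)
    (hs : StageInvariant R (a :: later) donors s) (ha : I.TopTwoPositive a (R a))
    (hD : I.value a (donorItems R s.parts s.avail donors) = 0) :
    c a s.avail (swapAll R (later.zip donors) s.parts) = a := by
  refine hc.eq_of_forall_lt (hs.mem_avail.2 (Or.inl rfl)) fun q hq hqa => ?_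
  rw [hs.swapAll_self h, hs.parts_eq a (by simp)]
  rcases List.mem_append.1 ((hs.mem_avail.1 hq).resolve_left hqa) with hlater | hdonor
  · have hswap := I.value_mono a (hs.swapAll_later_subset h hlater)
    linarith [I.value_union_le a ((R q).drop 1).toFinset (donorItems R s.parts s.avail donors),
      h.value_drop_le (List.mem_append_left _ hlater) 1, ha.value_drop_one_lt (h.column_nodup a)]
  · exact hs.value_swapAll_donor_lt h ha hD hdonor

theorem exists_arrive_eq_transfer (hc : I.IsRational c)
    (h : IsStageMatrix I R (a :: later) donors) (hs : StageInvariant R (a :: later) donors s)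
    (ha : I.TopTwoPositive a (R a)) :
    ∃ S ⊆ donorItems R s.parts s.avail donors,
      (later = [] → S = donorItems R s.parts s.avail donors) ∧
        arrive I c R donors later a s =
          ⟨transfer s.parts S a, s.avail.erase a,
            Function.update s.got a (transfer s.parts S a a)⟩ := by
  have hav : a ∈ s.avail := hs.mem_avail.2 (Or.inl rfl)
  unfold arrive
  simp only [hav, not_true_eq_false, if_false]
  split_ifs with hlater hpos
  · subst hlater
    refine ⟨_, subset_rfl, fun _ => rfl, ?_⟩
    simp only [present, choice_last hc h hs ha]
  · obtain ⟨hg, hgpos⟩ := Finset.mem_filter.1 (Finset.min'_mem _ hpos)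
    refine ⟨_, Finset.singleton_subset_iff.2 hg, fun hnil => absurd hnil hlater, ?_⟩
    simp only [present, choice_donated hc h hs hg hgpos]
  · have hD : I.value a (donorItems R s.parts s.avail donors) = 0 :=
      Finset.sum_eq_zero fun g hg => le_antisymm
        (not_lt.1 fun hlt => hpos ⟨g, Finset.mem_filter.2 ⟨hg, hlt⟩⟩) (I.nonneg a g)
    refine ⟨∅, Finset.empty_subset _, fun hnil => absurd hnil hlater, ?_⟩
    simp only [transfer_empty, present, rebundle_eq_swapAll hs, choice_rebundle hc h hs ha hD,
      hs.swapAll_self h, if_true]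

theorem StageInvariant.transfer (hs : StageInvariant R (a :: later) donors s)
    (h : IsStageMatrix I R (a :: later) donors) {S : Finset (Fin m)}
    (hS : S ⊆ donorItems R s.parts s.avail donors) (got : Parts n m) :
    StageInvariant R later donors ⟨transfer s.parts S a, s.avail.erase a, got⟩ where
  avail_eq := by
    rw [hs.avail_eq, List.cons_append, List.toFinset_cons,
      Finset.erase_insert (mt List.mem_toFinset.1 h.notMem)]
  parts_eq q hq := by
    have hqa : q ≠ a := ne_of_mem_of_not_mem (List.mem_append_left _ hq) h.notMem
    have hqd : q ∉ donors := List.disjoint_of_nodup_append h.tail.nodup hq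
    dsimp only
    rw [transfer_of_ne hqa, hs.parts_eq q (List.mem_cons_of_mem _ hq)]
    exact Finset.sdiff_eq_self_of_disjoint ((hs.disjoint_donorItems h hqd).mono_right hS)
  parts_subset d hd := by
    dsimp only
    rw [transfer_of_ne (ne_of_mem_of_not_mem (List.mem_append_right _ hd) h.notMem)]
    exact Finset.sdiff_subset.trans (hs.parts_subset d hd)
  subset_parts d hd := by
    dsimp only
    rw [transfer_of_ne (ne_of_mem_of_not_mem (List.mem_append_right _ hd) h.notMem),
      ← hs.parts_sdiff_donorItems h hd]
    exact Finset.sdiff_subset_sdiff subset_rfl hS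

theorem arrive_got_of_ne {q : Fin n} (hq : q ≠ a) :
    (arrive I c R donors later a s).got q = s.got q := by
  unfold arrive
  dsimp only
  split_ifs <;> exact Function.update_of_ne hq _ _

theorem picking_got_of_notMem {q : Fin n} (hq : q ∉ as) :
    (picking I c R donors as s).got q = s.got q := by
  induction as generalizing s with
  | nil => rfl
  | cons a later ih =>
    rw [List.mem_cons, not_or] at hq
    rw [picking, ih hq.2, arrive_got_of_ne hq.1]

theorem value_column_le_value_picking (hc : I.IsRational c) (h : IsStageMatrix I R as donors)
    (hs : StageInvariant R as donors s) {k : ℕ} (hk : k < as.length)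
    (hpos : ∀ j (hj : j < as.length), j ≤ k → I.TopTwoPositive as[j] (R as[j])) :
    I.value as[k] (R as[k]).toFinset ≤ I.value as[k] ((picking I c R donors as s).got as[k]) := by
  induction as generalizing s k with
  | nil => simp at hk
  | cons a later ih =>
    have ha : I.TopTwoPositive a (R a) := hpos 0 (Nat.succ_pos _) (Nat.zero_le _)
    obtain ⟨S, hS, -, harrive⟩ := exists_arrive_eq_transfer hc h hs ha
    rw [picking, harrive]
    cases k with
    | zero =>
      rw [List.getElem_cons_zero,
        picking_got_of_notMem fun hmem => h.notMem (List.mem_append_left _ hmem)]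
      dsimp only
      rw [Function.update_self, ← hs.parts_eq a (by simp)]
      exact I.value_mono a (subset_transfer_self _ _ _)
    | succ k =>
      exact ih h.tail (hs.transfer h hS _) (Nat.lt_of_succ_lt_succ hk) fun j hj hjk =>
        hpos (j + 1) (Nat.succ_lt_succ hj) (Nat.succ_le_succ hjk)

theorem picking_avail_parts (hc : I.IsRational c) (h : IsStageMatrix I R as donors)
    (hs : StageInvariant R as donors s) (hne : as ≠ [])
    (hpos : ∀ a ∈ as, I.TopTwoPositive a (R a)) :
    (picking I c R donors as s).avail = donors.toFinset ∧
      ∀ d ∈ donors, (picking I c R donors as s).parts d = ((R d).drop 2).toFinset := by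
  induction as generalizing s with
  | nil => exact absurd rfl hne
  | cons a later ih =>
    obtain ⟨S, hS, hlast, harrive⟩ :=
      exists_arrive_eq_transfer hc h hs (hpos a List.mem_cons_self)
    have hs' := hs.transfer h hS (Function.update s.got a (BoundedProp.transfer s.parts S a a))
    rw [picking, harrive]
    by_cases hlater : later = []
    · subst hlater
      refine ⟨hs'.avail_eq, fun d hd => ?_⟩
      rw [picking]
      dsimp only
      rw [hlast rfl, transfer_of_ne (ne_of_mem_of_not_mem hd h.notMem),
        hs.parts_sdiff_donorItems h hd]
    · exact ih h.tail hs' hlater fun b hb => hpos b (List.mem_cons_of_mem _ hb)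

end Arrival

/-! ### The recursion -/

section Recursion

variable {I : FairInstance n m} {c : Choice n m} {L : List (Fin n)}
  {l : List (Fin n × Fin m)}

theorem run_of_two_le (hL : 2 ≤ L.length) (U : Finset (Fin m)) (got : Parts n m) :
    run I c L U got =
      let s := picking I c (I.roundRobin L U) (L.drop (L.length / 2)) (L.take (L.length / 2))
        { parts := fun q => (I.roundRobin L U q).toFinset, avail := L.toFinset, got := got }
      run I c (L.drop (L.length / 2)) (s.avail.biUnion s.parts) s.got := by
  match L, hL with
  | a :: b :: L', _ => rw [run]

theorem run_of_notMem {q : Fin n} (hq : q ∉ L) (U : Finset (Fin m)) (got : Parts n m) :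
    run I c L U got q = got q := by
  induction hr : L.length using Nat.strong_induction_on generalizing L U got with
  | _ r ih =>
    subst hr
    rcases lt_or_ge L.length 2 with hlt | hL
    · match L, hlt with
      | [], _ => rw [run]
      | [a], _ =>
        rw [run]
        exact Function.update_of_ne (List.ne_of_not_mem_cons hq) _ _
    · rw [run_of_two_le hL]
      dsimp only
      rw [ih _ (by rw [List.length_drop]; omega) (fun h => hq (List.mem_of_mem_drop h)) _ _ rfl,
        picking_got_of_notMem fun h => hq (List.mem_of_mem_take h)]

/-- The state after the first stage of the algorithm for the agents `L`, if the picks of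
Round-Robin are those of `l`. -/
def firstStage (I : FairInstance n m) (c : Choice n m) (L : List (Fin n))
    (l : List (Fin n × Fin m)) (got : Parts n m) : StageState n m :=
  picking I c (column l) (L.drop (L.length / 2)) (L.take (L.length / 2))
    { parts := fun q => (column l q).toFinset, avail := L.toFinset, got := got }

theorem run_eq_run_firstStage (h : I.IsRoundRobin L l) (hL : 2 ≤ L.length) (got : Parts n m) :
    run I c L (pickedItems l) got =
      run I c (L.drop (L.length / 2))
        ((firstStage I c L l got).avail.biUnion (firstStage I c L l got).parts)
        (firstStage I c L l got).got := by
  rw [run_of_two_le hL, h.roundRobin_pickedItems]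
  rfl

theorem isStageMatrix_column (h : I.IsRoundRobin L l) :
    IsStageMatrix I (column l) (L.take (L.length / 2)) (L.drop (L.length / 2)) where
  nodup := by rw [List.take_append_drop]; exact h.nodup
  column_nodup := I.column_nodup h.pairwise
  disjoint _ _ := I.column_disjoint h.pairwise
  rowDominates := by rw [List.take_append_drop]; exact h.pairwise_rowDominates
  length_le := by rw [List.length_take, List.length_drop]; omega

theorem stageInvariant_column (L : List (Fin n)) (l : List (Fin n × Fin m)) (k : ℕ)
    (got : Parts n m) :
    StageInvariant (column l) (L.take k) (L.drop k)
      ⟨fun q => (column l q).toFinset, L.toFinset, got⟩ where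
  avail_eq := by rw [List.take_append_drop]
  parts_eq _ _ := rfl
  parts_subset _ _ := subset_rfl
  subset_parts _ _ _ hg := List.mem_toFinset.2 (List.mem_of_mem_drop (List.mem_toFinset.1 hg))

theorem value_column_le_value_run_of_lt_half (hc : I.IsRational c) (h : I.IsRoundRobin L l)
    (got : Parts n m) {k : ℕ} (hk : k < L.length / 2) (hkL : k < L.length)
    (hpos : ∀ j (hj : j < L.length), j ≤ k → I.TopTwoPositive L[j] (column l L[j])) :
    I.value L[k] (column l L[k]).toFinset ≤
      I.value L[k] (run I c L (pickedItems l) got L[k]) := by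
  have hk' : k < (L.take (L.length / 2)).length := by rw [List.length_take]; omega
  have hget : (L.take (L.length / 2))[k] = L[k] := List.getElem_take
  have hstage := value_column_le_value_picking hc (isStageMatrix_column h)
    (stageInvariant_column L l _ got) hk' fun j hj hjk => by
      rw [List.getElem_take]
      exact hpos j _ hjk
  have hnot : L[k] ∉ L.drop (L.length / 2) := fun hmem =>
    List.disjoint_take_drop h.nodup le_rfl (hget ▸ List.getElem_mem hk') hmem
  rw [run_eq_run_firstStage h (by omega), run_of_notMem hnot, firstStage]
  rwa [hget] at hstage

theorem exists_run_eq_run_laterPicks (hc : I.IsRational c) (h : I.IsRoundRobin L l)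
    (hL : 2 ≤ L.length) (got : Parts n m)
    (hpos : ∀ a ∈ L.take (L.length / 2), I.TopTwoPositive a (column l a)) :
    ∃ got', run I c L (pickedItems l) got =
      run I c (L.drop (L.length / 2)) (pickedItems (laterPicks L (L.length / 2) l)) got' := by
  have hne : L.take (L.length / 2) ≠ [] :=
    List.ne_nil_of_length_pos (by rw [List.length_take]; omega)
  obtain ⟨havail, hparts⟩ := picking_avail_parts hc (isStageMatrix_column h)
    (stageInvariant_column L l _ got) hne hpos
  refine ⟨(firstStage I c L l got).got, ?_⟩
  rw [run_eq_run_firstStage h hL, h.pickedItems_laterPicks]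
  congr 1
  unfold firstStage
  rw [havail]
  exact Finset.biUnion_congr rfl fun d hd => hparts d (List.mem_toFinset.1 hd)

theorem value_column_le_value_run_singleton (a : Fin n) (l : List (Fin n × Fin m))
    (got : Parts n m) :
    I.value a (column l a).toFinset ≤ I.value a (run I c [a] (pickedItems l) got a) := by
  rw [run, Function.update_self]
  exact I.value_mono a fun g hg => mem_pickedItems.2 ⟨a, mem_column.1 (List.mem_toFinset.1 hg)⟩

theorem clog_two_succ_add_one_le {i j : ℕ} (hi : 0 < i) (hj : j ≤ i) :
    Nat.clog 2 (j + 1) + 1 ≤ Nat.clog 2 (i + j + 1) := by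
  rw [Nat.clog_of_two_le one_lt_two (n := i + j + 1) (by omega)]
  exact Nat.succ_le_succ (Nat.clog_mono_right 2 (by omega))

/-- Among the donors of a stage the columns lose two rows, but an agent at position `mid + j` moves
to position `j ≤ mid`, which takes one off the logarithm. -/
theorem value_column_sub_le_value_run (hc : I.IsRational c) (h : I.IsRoundRobin L l)
    (got : Parts n m) {k : ℕ} (hk : k < L.length)
    (hlarge : ∀ j (hj : j < L.length), j ≤ k →
      2 * (Nat.clog 2 (j + 1) : ℝ) + 1 < I.value L[j] (column l L[j]).toFinset) :
    I.value L[k] (column l L[k]).toFinset - 2 * Nat.clog 2 (k + 1) ≤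
      I.value L[k] (run I c L (pickedItems l) got L[k]) := by
  induction hr : L.length using Nat.strong_induction_on generalizing L l got k with
  | _ r ih =>
    subst hr
    have hpos (j : ℕ) (hj : j < L.length) (hjk : j ≤ k) : I.TopTwoPositive L[j] (column l L[j]) :=
      I.topTwoPositive_of_one_lt (I.column_pairwise_val_le h.pairwise _)
        (lt_of_le_of_lt (by simp) (hlarge j hj hjk))
    rcases lt_or_ge k (L.length / 2) with hlt | hge
    · exact (sub_le_self _ (by positivity)).trans
        (value_column_le_value_run_of_lt_half hc h got hlt hk hpos)
    rcases lt_or_ge L.length 2 with hone | htwo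
    · obtain ⟨a, rfl⟩ := List.length_eq_one_iff.1 (show L.length = 1 by omega)
      obtain rfl : k = 0 := by simpa using hk
      exact (sub_le_self _ (by positivity)).trans (value_column_le_value_run_singleton a l got)
    · obtain ⟨got', hrun⟩ := exists_run_eq_run_laterPicks hc h htwo got fun a ha => by
        obtain ⟨j, hj, rfl⟩ := List.getElem_of_mem ha
        rw [List.getElem_take]
        rw [List.length_take] at hj
        exact hpos j _ (by omega)
      obtain ⟨i, rfl⟩ := Nat.exists_eq_add_of_le hge
      have hclog (j : ℕ) (hj : j ≤ L.length / 2) :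
          (Nat.clog 2 (j + 1) : ℝ) + 1 ≤ Nat.clog 2 (L.length / 2 + j + 1) :=
        mod_cast clog_two_succ_add_one_le (by omega) hj
      have hdrop (j : ℕ) (hj : L.length / 2 + j < L.length) :=
        h.value_column_le_value_column_laterPicks_add_two
          (k := L.length / 2) (a := L[L.length / 2 + j])
          (List.mem_drop_iff_getElem.2 ⟨j, by omega, by simp only [Nat.add_comm]⟩)
      have hrec := ih (L.drop (L.length / 2)).length (by rw [List.length_drop]; omega)
        (h.laterPicks _) got' (k := i) (by rw [List.length_drop]; omega) (fun j hj hji => by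
          rw [List.length_drop] at hj
          rw [List.getElem_drop]
          linarith [hlarge (L.length / 2 + j) (by omega) (by omega), hdrop j (by omega),
            hclog j (by omega)]) rfl
      rw [List.getElem_drop, ← hrun] at hrec
      linarith [hdrop i hk, hclog i (by omega)]

end Recursion

end BoundedProp

/-! ### Greedy arrival orders -/

namespace FairInstance

open BoundedProp

variable {n m : ℕ} {I : FairInstance n m} {c : Choice n m}

theorem logPos_eq_clog (k : Fin n) : logPos k = Nat.clog 2 ((k : ℕ) + 1) := by
  have hceil := Real.ceil_logb_natCast (b := 2) (r := ((k : ℕ) + 1 : ℕ)) (Nat.cast_nonneg _)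
  rw [Int.clog_natCast] at hceil
  rw [← hceil, logPos, Nat.cast_ofNat, Nat.cast_add_one]

theorem logPos_mono : Monotone (logPos : Fin n → ℤ) := fun j k hjk => by
  rw [logPos_eq_clog, logPos_eq_clog]
  exact_mod_cast Nat.clog_mono_right 2 (Nat.succ_le_succ hjk)

theorem IsGreedyOrder.le_value {τ : Equiv.Perm (Fin n)} (hτ : I.IsGreedyOrder τ)
    (hc : I.IsRational c) (k : Fin n) :
    I.prop (τ k) - 2 * (logPos k : ℝ) - 2 ≤ I.value (τ k) (I.boundedProp τ c (τ k)) := by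
  rcases lt_or_ge (I.prop (τ k)) (2 * ((logPos k : ℝ) + 1)) with hlt | hge
  · linarith [I.value_nonneg (τ k) (I.boundedProp τ c (τ k))]
  have hrr := I.isRoundRobin_serialPicks (List.nodup_ofFn.2 τ.injective) m Finset.univ
  have hitems := I.pickedItems_serialPicks (List.replicate m (List.ofFn τ)).flatten Finset.univ
    (by simpa using Nat.le_mul_of_pos_right m k.pos)
  set l := I.serialPicks (List.replicate m (List.ofFn τ)).flatten Finset.univ
  have hcolumn (j : Fin n) : I.prop (τ j) - 1 < I.value (τ j) (column l (τ j)).toFinset := by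
    have hshare := hrr.share_sub_one_lt_value_column (List.mem_ofFn.2 ⟨j, rfl⟩)
    rwa [hitems, List.length_ofFn] at hshare
  have hclog (j : Fin n) : ((logPos j : ℤ) : ℝ) = Nat.clog 2 ((j : ℕ) + 1) :=
    mod_cast congrArg (Int.cast (R := ℝ)) (logPos_eq_clog j)
  have hrun := value_column_sub_le_value_run hc hrr (fun _ => ∅)
    (hk := by rw [List.length_ofFn]; exact k.2) fun j hj hjk => by
      rw [List.length_ofFn] at hj
      have hmono : ((logPos ⟨j, hj⟩ : ℤ) : ℝ) ≤ logPos k := mod_cast logPos_mono hjk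
      have hbig := hτ ⟨j, hj⟩ k hjk (by linarith)
      rw [List.getElem_ofFn, ← hclog ⟨j, hj⟩]
      linarith [hcolumn ⟨j, hj⟩]
  rw [hitems, List.getElem_ofFn, Fin.eta, ← hclog] at hrun
  unfold boundedProp
  linarith [hcolumn k]

end FairInstance

/-! ### Ranks -/

/-- The position of `a` when the indices below `n` are sorted by increasing values of `f`. -/
def sortRank {α : Type*} [LinearOrder α] (f : ℕ → α) (n a : ℕ) : ℕ :=
  Nat.count (fun b => f b < f a) n

section sortRank

variable {α : Type*} [LinearOrder α] {f : ℕ → α} {n a b : ℕ}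

theorem sortRank_lt_sortRank (ha : a < n) (h : f a < f b) : sortRank f n a < sortRank f n b := by
  simp only [sortRank, Nat.count_eq_card_filter_range]
  refine Finset.card_lt_card (Finset.ssubset_iff_of_subset ?_ |>.2 ⟨a, by simp [ha, h], by simp⟩)
  exact Finset.monotone_filter_right _ fun x _ hx => hx.trans h

theorem sortRank_lt (ha : a < n) : sortRank f n a < n :=
  (Nat.count_le _).lt_of_ne fun h => lt_irrefl _ (Nat.count_iff_forall.1 h a ha)

theorem sortRank_injOn (hf : Function.Injective f) : Set.InjOn (sortRank f n) (Set.Iio n) := by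
  intro a ha b hb h
  by_contra hne
  rcases lt_or_gt_of_ne (hf.ne hne) with hlt | hlt
  · exact h.not_lt (sortRank_lt_sortRank ha hlt)
  · exact h.not_gt (sortRank_lt_sortRank hb hlt)

end sortRank

namespace RAM

variable {inp : ℕ → ℕ → ℝ}

/-! ### Program logic -/

/-- The total-correctness triple of the machine: started in `s`, the program `p` halts after at most
`T` steps in a state with property `Q`. -/
def Halts (inp : ℕ → ℕ → ℝ) (p : Prog) (s : State) (T : ℕ) (Q : State → Prop) : Prop :=
  ∃ t s', Exec inp p s t s' ∧ t ≤ T ∧ Q s'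

namespace Halts

variable {p q : Prog} {s : State} {T T' : ℕ} {P Q : State → Prop}

theorem of_exec {s' : State} (h : Exec inp p s 1 s') (hQ : Q s') : Halts inp p s 1 Q :=
  ⟨1, s', h, le_rfl, hQ⟩

theorem mono (h : Halts inp p s T P) (hT : T ≤ T') (hQ : ∀ s', P s' → Q s') :
    Halts inp p s T' Q := by
  obtain ⟨t, s', hexec, ht, hs'⟩ := h
  exact ⟨t, s', hexec, ht.trans hT, hQ _ hs'⟩

theorem seq (hp : Halts inp p s T P) (hq : ∀ s', P s' → Halts inp q s' T' Q) :
    Halts inp (.seq p q) s (T + T') Q := by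
  obtain ⟨t, s', hexec, ht, hs'⟩ := hp
  obtain ⟨t', s'', hexec', ht', hs''⟩ := hq s' hs'
  exact ⟨t + t', s'', .seq hexec hexec', Nat.add_le_add ht ht', hs''⟩

theorem exec_seq {s' : State} (hp : Exec inp p s 1 s') (hq : Halts inp q s' T Q) :
    Halts inp (.seq p q) s (1 + T) Q :=
  (of_exec (Q := (· = s')) hp rfl).seq fun _ h => h ▸ hq

theorem ifI {x y : ℕ} (hp : s.idx x < s.idx y → Halts inp p s T Q)
    (hq : s.idx y ≤ s.idx x → Halts inp q s T Q) : Halts inp (.ifI x y p q) s (T + 1) Q := by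
  rcases lt_or_ge (s.idx x) (s.idx y) with hlt | hge
  · obtain ⟨t, s', hexec, ht, hs'⟩ := hp hlt
    exact ⟨t + 1, s', .ifI_lt hlt hexec, Nat.succ_le_succ ht, hs'⟩
  · obtain ⟨t, s', hexec, ht, hs'⟩ := hq hge
    exact ⟨t + 1, s', .ifI_ge hge hexec, Nat.succ_le_succ ht, hs'⟩

theorem ifV {x y : ℕ} (hp : s.val x < s.val y → Halts inp p s T Q)
    (hq : s.val y ≤ s.val x → Halts inp q s T Q) : Halts inp (.ifV x y p q) s (T + 1) Q := by
  rcases lt_or_ge (s.val x) (s.val y) with hlt | hge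
  · obtain ⟨t, s', hexec, ht, hs'⟩ := hp hlt
    exact ⟨t + 1, s', .ifV_lt hlt hexec, Nat.succ_le_succ ht, hs'⟩
  · obtain ⟨t, s', hexec, ht, hs'⟩ := hq hge
    exact ⟨t + 1, s', .ifV_ge hge hexec, Nat.succ_le_succ ht, hs'⟩

theorem whileI {x y N : ℕ} (Inv : ℕ → State → Prop)
    (hreg : ∀ k s, Inv k s → s.idx x = k ∧ s.idx y = N)
    (hbody : ∀ k s, k < N → Inv k s → Halts inp p s T (Inv (k + 1))) (hs : Inv 0 s) :
    Halts inp (.whileI x y p) s (N * (T + 1) + 1) (Inv N) := by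
  suffices hfrom : ∀ d k s, k + d = N → Inv k s →
      Halts inp (.whileI x y p) s (d * (T + 1) + 1) (Inv N) from hfrom N 0 s (Nat.zero_add N) hs
  intro d
  induction d with
  | zero =>
    rintro k s rfl hs
    obtain ⟨hx, hy⟩ := hreg k s hs
    exact ⟨1, s, .while_ge (by omega), by omega, hs⟩
  | succ d ih =>
    intro k s hk hs
    obtain ⟨hx, hy⟩ := hreg k s hs
    obtain ⟨t, s', hexec, ht, hs'⟩ := hbody k s (by omega) hs
    obtain ⟨t', s'', hexec', ht', hs''⟩ := ih (k + 1) s' (by omega) hs'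
    refine ⟨t + t' + 1, s'', .while_lt (by omega) hexec hexec', ?_, hs''⟩
    rw [Nat.succ_mul]
    omega

end Halts

/-! ### A program that sorts the agents

Index registers: 0 and 1 keep `n` and `m`, 2 the constant 1, 3 the agent being ranked, 4 the
agent compared with it, 5 the current item, 6 the rank; 7 is written only to fill empty branches.
Value registers: 0 and 1 hold the totals of the agents in the index registers 3 and 4. -/

/-- The total value of the first `m` items for agent `a` in an input table. -/
def rowTotal (inp : ℕ → ℕ → ℝ) (m a : ℕ) : ℝ := ∑ g ∈ Finset.range m, inp a g

/-- The program that writes the total of the agent in index register `a` to value register `d`. -/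
def rowSum (d a : ℕ) : Prog :=
  .seq (.setV d 0) (.seq (.setI 5 0)
    (.whileI 5 1 (.seq (.input 2 a 5) (.seq (.addV d d 2) (.addI 5 5 2)))))

theorem rowSum_halts {d a : ℕ} (hd : d ≠ 2) (ha : a ≠ 5) (s : State) (hone : s.idx 2 = 1) :
    Halts inp (rowSum d a) s (4 * s.idx 1 + 3) fun s' =>
      (∀ r ≠ 5, s'.idx r = s.idx r) ∧ s'.mem = s.mem ∧
      (∀ r, r ≠ d → r ≠ 2 → s'.val r = s.val r) ∧
      s'.val d = rowTotal inp (s.idx 1) (s.idx a) := by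
  refine (Halts.exec_seq (.setV _ _ _) (Halts.exec_seq (.setI _ _ _)
    (Halts.whileI (N := s.idx 1) (T := 3) (fun k s' => s'.idx 5 = k ∧
      (∀ r ≠ 5, s'.idx r = s.idx r) ∧ s'.mem = s.mem ∧
      (∀ r, r ≠ d → r ≠ 2 → s'.val r = s.val r) ∧ s'.val d = rowTotal inp k (s.idx a))
      (fun k s' h => ⟨h.1, h.2.1 1 (by norm_num)⟩) ?_ ?_))).mono (by omega) fun s' h => h.2
  · rintro k s' - ⟨hitem, hidx, hmem, hval, hsum⟩
    refine Halts.exec_seq (.input _ _ _ _) (Halts.exec_seq (.addV _ _ _ _)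
      (Halts.of_exec (.addI _ _ _ _) ⟨?_, fun r hr => ?_, hmem, fun r hr hr2 => ?_, ?_⟩))
    · simp [hitem, hidx 2 (by norm_num), hone]
    · simp [hr, hidx r hr]
    · simp [hr, hr2, hval r hr hr2]
    · simp [hd, hsum, hitem, hidx a ha, rowTotal, Finset.sum_range_succ]
  · exact ⟨by simp, fun r hr => by simp [hr], rfl, fun r hr _ => by simp [hr], by simp [rowTotal]⟩

/-- The program that increases index register `6` if the agent in register `4` precedes the agent in
register `3` in the order of decreasing totals. -/
def compareStep : Prog :=
  .ifV 0 1 (.addI 6 6 2) (.ifV 1 0 (.setI 7 0) (.ifI 4 3 (.addI 6 6 2) (.setI 7 0)))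

theorem compareStep_halts {S : ℕ → ℝ} (s : State) (hone : s.idx 2 = 1)
    (h0 : s.val 0 = S (s.idx 3)) (h1 : s.val 1 = S (s.idx 4)) :
    Halts inp compareStep s 4 fun s' =>
      (∀ r, r ≠ 6 → r ≠ 7 → s'.idx r = s.idx r) ∧ s'.mem = s.mem ∧ s'.val = s.val ∧
      s'.idx 6 = s.idx 6 + if descLex S (s.idx 4) < descLex S (s.idx 3) then 1 else 0 := by
  set Q : State → Prop := fun s' =>
    (∀ r, r ≠ 6 → r ≠ 7 → s'.idx r = s.idx r) ∧ s'.mem = s.mem ∧ s'.val = s.val ∧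
    s'.idx 6 = s.idx 6 + if descLex S (s.idx 4) < descLex S (s.idx 3) then 1 else 0
  have hcount (h : descLex S (s.idx 4) < descLex S (s.idx 3)) : Halts inp (.addI 6 6 2) s 1 Q :=
    Halts.of_exec (.addI _ _ _ _) ⟨fun r hr _ => by simp [hr], rfl, rfl, by simp [h, hone]⟩
  have hskip (h : descLex S (s.idx 3) ≤ descLex S (s.idx 4)) : Halts inp (.setI 7 0) s 1 Q :=
    Halts.of_exec (.setI _ _ _) ⟨fun r _ hr => by simp [hr], rfl, rfl, by simp [h.not_gt]⟩
  rw [descLex_lt_descLex, ← h0, ← h1] at hcount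
  rw [descLex_le_descLex, ← h0, ← h1] at hskip
  refine Halts.ifV (T := 3) (fun hlt => ?_) fun hge => Halts.ifV (T := 2) (fun hgt => ?_) fun hle =>
    Halts.ifI (T := 1) (fun hidx => ?_) fun hidx => ?_
  · exact (hcount (.inl hlt)).mono (by norm_num) fun _ h => h
  · exact (hskip (.inl hgt)).mono (by norm_num) fun _ h => h
  · exact hcount (.inr ⟨hge.antisymm hle, hidx⟩)
  · exact hskip (.inr ⟨hle.antisymm hge, hidx⟩)

/-- The program that compares the agent in register `4` with the agent in register `3` and proceeds
to the next agent. -/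
def rankStep : Prog := .seq (rowSum 1 4) (.seq compareStep (.addI 4 4 2))

theorem rankStep_halts (s : State) (hone : s.idx 2 = 1)
    (h0 : s.val 0 = rowTotal inp (s.idx 1) (s.idx 3)) :
    Halts inp rankStep s (4 * s.idx 1 + 8) fun s' =>
      (∀ r < 4, s'.idx r = s.idx r) ∧ s'.mem = s.mem ∧ s'.val 0 = s.val 0 ∧
      s'.idx 4 = s.idx 4 + 1 ∧
      s'.idx 6 = s.idx 6 + if descLex (rowTotal inp (s.idx 1)) (s.idx 4) <
        descLex (rowTotal inp (s.idx 1)) (s.idx 3) then 1 else 0 := by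
  refine (rowSum_halts (d := 1) (a := 4) (by norm_num) (by norm_num) s hone).seq
    (T' := 4 + 1) ?_
  rintro u ⟨uidx, umem, uval, utotal⟩
  have hcompare := compareStep_halts (inp := inp) (S := rowTotal inp (s.idx 1)) u
    (by rw [uidx 2 (by norm_num), hone])
    (by rw [uval 0 (by norm_num) (by norm_num), uidx 3 (by norm_num), h0])
    (by rw [utotal, uidx 4 (by norm_num)])
  refine hcompare.seq ?_
  rintro w ⟨widx, wmem, wval, wcount⟩
  have hidx (r : ℕ) (hr : r < 5) : w.idx r = s.idx r := by
    rw [widx r (by omega) (by omega), uidx r (by omega)]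
  refine Halts.of_exec (.addI _ _ _ _) ⟨fun r hr => ?_, wmem.trans umem, ?_, ?_, ?_⟩
  · simp [hr.ne, hidx r (by omega)]
  · simp [wval, uval 0 (by norm_num) (by norm_num)]
  · simp [hidx 4 (by norm_num), hidx 2 (by norm_num), hone]
  · simp [wcount, uidx 3 (by norm_num), uidx 4 (by norm_num), uidx 6 (by norm_num)]

/-- The program that writes the rank of the agent in register `3` to register `6`. -/
def computeRank : Prog := .seq (.setI 6 0) (.seq (.setI 4 0) (.whileI 4 0 rankStep))

theorem computeRank_halts (s : State) (hone : s.idx 2 = 1)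
    (h0 : s.val 0 = rowTotal inp (s.idx 1) (s.idx 3)) :
    Halts inp computeRank s (s.idx 0 * (4 * s.idx 1 + 9) + 3) fun s' =>
      (∀ r < 4, s'.idx r = s.idx r) ∧ s'.mem = s.mem ∧
      s'.idx 6 = sortRank (descLex (rowTotal inp (s.idx 1))) (s.idx 0) (s.idx 3) := by
  refine (Halts.exec_seq (.setI _ _ _) (Halts.exec_seq (.setI _ _ _)
    (Halts.whileI (N := s.idx 0) (T := 4 * s.idx 1 + 8) (fun k s' => s'.idx 4 = k ∧
      s'.val 0 = s.val 0 ∧ (∀ r < 4, s'.idx r = s.idx r) ∧ s'.mem = s.mem ∧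
      s'.idx 6 = sortRank (descLex (rowTotal inp (s.idx 1))) k (s.idx 3))
      (fun k s' h => ⟨h.1, h.2.2.1 0 (by norm_num)⟩) ?_ ?_))).mono (le_of_eq (by ring))
    fun s' h => h.2.2
  · rintro k s' - ⟨hk, hval, hidx, hmem, hrank⟩
    have hstep := rankStep_halts (inp := inp) s' (by rw [hidx 2 (by norm_num), hone])
      (by rw [hval, h0, hidx 1 (by norm_num), hidx 3 (by norm_num)])
    rw [hidx 1 (by norm_num), hidx 3 (by norm_num), hk, hval, hmem, hrank] at hstep
    refine hstep.mono le_rfl ?_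
    rintro u ⟨uidx, umem, uval, uk, urank⟩
    exact ⟨uk, uval, fun r hr => (uidx r hr).trans (hidx r hr), umem,
      urank.trans (Nat.count_succ _ _).symm⟩
  · refine ⟨by simp, rfl, fun r hr => ?_, rfl, by simp [sortRank]⟩
    simp [hr.ne, show r ≠ 6 by omega]

/-- The program that stores the agent in register `3` at its rank and proceeds to the next agent. -/
def sortStep : Prog := .seq (rowSum 0 3) (.seq computeRank (.seq (.storeI 6 3) (.addI 3 3 2)))

theorem sortStep_halts (s : State) (hone : s.idx 2 = 1) :
    Halts inp sortStep s (s.idx 0 * (4 * s.idx 1 + 9) + (4 * s.idx 1 + 8)) fun s' =>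
      (∀ r < 3, s'.idx r = s.idx r) ∧ s'.idx 3 = s.idx 3 + 1 ∧
      s'.mem = Function.update s.mem
        (sortRank (descLex (rowTotal inp (s.idx 1))) (s.idx 0) (s.idx 3)) (s.idx 3) := by
  refine ((rowSum_halts (d := 0) (a := 3) (by norm_num) (by norm_num) s hone).seq
    (T' := s.idx 0 * (4 * s.idx 1 + 9) + 3 + (1 + 1)) ?_).mono (by omega) fun _ h => h
  rintro u ⟨uidx, umem, -, utotal⟩
  have hrank := computeRank_halts (inp := inp) u (by rw [uidx 2 (by norm_num), hone])
    (by rw [utotal, uidx 1 (by norm_num), uidx 3 (by norm_num)])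
  rw [uidx 0 (by norm_num), uidx 1 (by norm_num), uidx 3 (by norm_num), umem] at hrank
  refine hrank.seq ?_
  rintro w ⟨widx, wmem, wrank⟩
  have hidx (r : ℕ) (hr : r < 4) : w.idx r = s.idx r := by rw [widx r hr, uidx r (by omega)]
  refine Halts.exec_seq (.storeI _ _ _) (Halts.of_exec (.addI _ _ _ _) ⟨fun r hr => ?_, ?_, ?_⟩)
  · simp [hr.ne, hidx r (by omega)]
  · simp [hidx 3 (by norm_num), hidx 2 (by norm_num), hone]
  · simp [wmem, wrank, hidx 3 (by norm_num)]

/-- The program that sorts the agents by decreasing totals in the index memory. -/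
def sortAgents : Prog := .seq (.setI 2 1) (.whileI 3 0 sortStep)

theorem sortAgents_halts (n m : ℕ) :
    Halts inp sortAgents (start n m) (n * ((n + 1) * (4 * m + 9)) + 2) fun s' =>
      ∀ a < n, s'.mem (sortRank (descLex (rowTotal inp m)) n a) = a := by
  refine (Halts.exec_seq (.setI _ _ _) 
    (Halts.whileI (N := n) (T := n * (4 * m + 9) + (4 * m + 8))
    (fun k s' => s'.idx 3 = k ∧ s'.idx 0 = n ∧ s'.idx 1 = m ∧ s'.idx 2 = 1 ∧
      ∀ a < k, s'.mem (sortRank (descLex (rowTotal inp m)) n a) = a)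
    (fun k s' h => ⟨h.1, h.2.1⟩) ?_ ?_)).mono ?_ fun s' h => h.2.2.2.2
  · rintro k s' hk ⟨rfl, rfl, rfl, hone, hmem⟩
    refine (sortStep_halts s' hone).mono le_rfl ?_
    rintro u ⟨uidx, uk, umem⟩
    refine ⟨uk, uidx 0 (by norm_num), uidx 1 (by norm_num),
      (uidx 2 (by norm_num)).trans hone, fun a ha => ?_⟩
    rw [umem]
    rcases Nat.lt_succ_iff_lt_or_eq.1 ha with hlt | rfl
    · have hne : sortRank (descLex (rowTotal inp (s'.idx 1))) (s'.idx 0) a ≠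
          sortRank (descLex (rowTotal inp (s'.idx 1))) (s'.idx 0) (s'.idx 3) := fun h =>
        hlt.ne (sortRank_injOn (descLex_injective _) (hlt.trans hk) hk h)
      rw [Function.update_of_ne hne, hmem a hlt]
    · rw [Function.update_self]
  · simp [start]
  · exact le_of_eq (by ring)

theorem rowTotal_table {n m : ℕ} (I : FairInstance n m) (a : Fin n) :
    rowTotal (table I) m a = I.value a Finset.univ := by
  rw [rowTotal, Finset.sum_range, FairInstance.value]
  exact Finset.sum_congr rfl fun g _ => by simp [table]

theorem exists_sortAgents_computesOrder {n m : ℕ} (I : FairInstance n m) :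
    ∃ τ : Equiv.Perm (Fin n),
      ComputesOrder sortAgents I τ (n * ((n + 1) * (4 * m + 9)) + 2) ∧ Antitone (I.prop ∘ τ) := by
  set f := descLex (rowTotal (table I) m)
  let ρ : Fin n → Fin n := fun a => ⟨sortRank f n a, sortRank_lt a.2⟩
  have hρ : Function.Injective ρ := fun a b h =>
    Fin.ext (sortRank_injOn (descLex_injective _) a.2 b.2 (congrArg Fin.val h))
  let e : Equiv.Perm (Fin n) := .ofBijective ρ (Finite.injective_iff_bijective.1 hρ)
  have hrank (k : Fin n) : sortRank f n (e.symm k) = k := congrArg Fin.val (e.apply_symm_apply k)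
  refine ⟨e.symm, ?_, fun k l hkl => div_le_div_of_nonneg_right ?_ (Nat.cast_nonneg n)⟩
  · obtain ⟨t, s, hexec, ht, hs⟩ := sortAgents_halts (inp := table I) n m
    exact ⟨t, s, hexec, ht, fun k => hrank k ▸ hs (e.symm k) (e.symm k).2⟩
  · have hle : f (e.symm k) ≤ f (e.symm l) := not_lt.1 fun hlt =>
      (sortRank_lt_sortRank (e.symm l).2 hlt).not_ge (by rw [hrank, hrank]; exact hkl)
    have htotal := le_of_descLex_le hle
    rwa [rowTotal_table, rowTotal_table] at htotal

end RAM

end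

theorem theorem8 :
    ∃ (prog : RAM.Prog) (bound : Polynomial ℕ),
      ∀ (n m : ℕ) (I : FairInstance n m),
        ∃ τ : Equiv.Perm (Fin n),
          RAM.ComputesOrder prog I τ (bound.eval (n + m)) ∧
          I.IsGreedyOrder τ ∧
          ∀ c : Choice n m, I.IsRational c →
            ∀ k : Fin n,
              I.prop (τ k) - 2 * (FairInstance.logPos k : ℝ) - 2 ≤
                I.value (τ k) (I.boundedProp τ c (τ k)) := by
  refine ⟨RAM.sortAgents,
    Polynomial.X * ((Polynomial.X + 1) * (4 * Polynomial.X + 9)) + 2, fun n m I => ?_⟩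
  obtain ⟨τ, ⟨t, s, hexec, ht, hs⟩, hanti⟩ := RAM.exists_sortAgents_computesOrder I
  have hgreedy : I.IsGreedyOrder τ := fun k l hkl h => h.trans (hanti hkl)
  refine ⟨τ, ⟨t, s, hexec, ht.trans ?_, hs⟩, hgreedy, fun c hc k => hgreedy.le_value hc k⟩
  simp only [Polynomial.eval_add, Polynomial.eval_mul, Polynomial.eval_X, Polynomial.eval_one,
    Polynomial.eval_ofNat]
  gcongr <;> omega
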